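/- Let $\Omega\subseteq A^{\mathbb N}$ be a minimal aperiodic one-sided shift on a finite alphabet $A$ (nonempty, closed, invariant under the shift $T$, every orbit dense, no periodic points), with language $\mathcal L$. Let $p(n)$ be the number of words of length $n$ in $\mathcal L$, and suppose that for some $K,N_0$ we have $p(n+1)-p(n)=K$ for all $n\ge N_0$. Let $\mathcal E(\Omega)$ be the set of ergodic $T$-invariant probability measures on $\Omega$. For each $\nu\in\mathcal E(\Omega)$ fix a point $x^{(\nu)}\in\Omega$ that is generic for $\nu$: the frequency of every word $u$ in the prefixes of $x^{(\nu)}$ converges to $\nu([u])$, where $[u]$ is the cylinder of $u$. **Special Rauzy graphs.** A word of $\mathcal L$ is left (right) special if it has at least two left (right) extensions in $\mathcal L$ by one letter, and bispecial if it is both. The special Rauzy graph $\Gamma^{\mathrm{Spec}}(n)$, $n\ge1$, is the directed multigraph that has one vertex for each word of length $n$ that is special on exactly one side, and two vertices $w_\ell,w_r$ for each bispecial word $w$ of length $n$. It has one edge for each path of positive length in the Rauzy graph of order $n$ that joins two special words through non-special words only; such an edge begins at $w_r$ if the path begins at a bispecial $w$, and ends at $w_\ell$ if the path ends at a bispecial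 $w$. It also has one edge $w_\ell\to w_r$ for each bispecial $w$. A vertex of such a multigraph is called left special if it has more than one incoming edge, and right special if it has more than one outgoing edge. **Limiting graph.** Let $\mathcal J\subseteq\{1,2,\dots\}$ be infinite and let $K_\ell,K_r\le K$ be such that for every $n\in\mathcal J$ there are exactly $K_\ell$ left special and exactly $K_r$ right special words of length $n$. Let $\Lambda$ be a directed multigraph with a fixed isomorphism $\Lambda\cong\Gamma^{\mathrm{Spec}}(n)$ for every $n\in\mathcal J$, and let $w^{(n)}$ be the word of length $n$ that corresponds to the vertex $w$ of $\Lambda$. Suppose that for each vertex $w$ the words $w^{(n)}$ generate a $T$-invariant probability measure $\mu_w$ on $\Omega$: for every word $u$, the number of occurrences of $u$ in $w^{(n)}$, divided by $n$, tends to $\mu_w([u])$ as $\mathcal J\ni n\to\infty$. **Coloring.** Put $L=K+1$. For a word $w$ of length $n$ and $x\in A^{\mathbb N}$, let $\mathcal D_L(w,x)$ be the limsup, as $N\to\infty$, of the proportion of indices $1\le j\le N$ such that $w$ begins in $x$ at some position $i$ with $(j-1)Ln<i\le jLn$. Put $\mathcal D_L(\mu_w,\nu)=\limsup_{\mathcal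 J\ni n\to\infty}\mathcal D_L(w^{(n)},x^{(\nu)})$. A vertex $w$ of $\Lambda$ is colored by $\nu\in\mathcal E(\Omega)$, written $\mathcal C(w)=\nu$, if $\mathcal D_L(\mu_w,\nu)>0$. Then each vertex is colored by at most one $\nu\in\mathcal E(\Omega)$, so that $\mathcal C$ is well defined, and the following hold. 1. For each $\nu\in\mathcal E(\Omega)$ there are a left special vertex $u$ and a right special vertex $v$ of $\Lambda$ with $\mathcal C(u)=\mathcal C(v)=\nu$. 2. If $v$ is a right special vertex of $\Lambda$ and $\mathcal C(v)=\nu$, then there is a unique vertex $w$ with $w\to v$ in $\Lambda$, it satisfies $\mathcal C(w)=\nu$, and there is a vertex $w'$ with $v\to w'$ in $\Lambda$ and $\mathcal C(w')=\nu$. 3. If $u$ is a left special vertex of $\Lambda$ and $\mathcal C(u)=\nu$, then there is a unique vertex $w$ with $u\to w$ in $\Lambda$, it satisfies $\mathcal C(w)=\nu$, and there is a vertex $w'$ with $w'\to u$ in $\Lambda$ and $\mathcal C(w')=\nu$. -/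

import Mathlib

open MeasureTheory Filter Topology

universe u v

namespace SpecialRauzy

section Words

variable {A : Type u}

/-- The left shift on one-sided sequences. Sequences are indexed from `0`. -/
def shift (x : ℕ → A) : ℕ → A := fun k => x (k + 1)

/-- The word of length `n` that begins at position `i` in `x`. -/
def factor (x : ℕ → A) (i n : ℕ) : List A := List.ofFn fun k : Fin n => x (i + k)

/-- The word `w` begins at position `i` in `x`. -/
def OccursAt (w : List A) (x : ℕ → A) (i : ℕ) : Prop := factor x i w.length = w

/-- The cylinder set of a word. -/
def wordCylinder (w : List A) : Set (ℕ → A) := {x | OccursAt w x 0}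

/-- The number of occurrences of the word `s` in the word `w`. -/
noncomputable def occurrences (s w : List A) : ℕ :=
  {j : ℕ | j + s.length ≤ w.length ∧ s <+: w.drop j}.ncard

/-- The language of `Ω`: all words that occur in some point of `Ω`. -/
def language (Ω : Set (ℕ → A)) : Set (List A) := {w | ∃ x ∈ Ω, ∃ i, OccursAt w x i}

/-- The words of length `n` in the language. -/
def languageOf (Ω : Set (ℕ → A)) (n : ℕ) : Set (List A) := {w ∈ language Ω | w.length = n}

/-- The complexity function. -/
noncomputable def complexity (Ω : Set (ℕ → A)) (n : ℕ) : ℕ := (languageOf Ω n).ncard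

/-- A nonempty, closed, shift-invariant set in which every orbit is dense. -/
structure IsMinimalShift [TopologicalSpace A] (Ω : Set (ℕ → A)) : Prop where
  nonempty : Ω.Nonempty
  isClosed : IsClosed Ω
  mapsTo : Set.MapsTo shift Ω Ω
  dense_orbit : ∀ x ∈ Ω, Ω ⊆ closure (Set.range fun k : ℕ => shift^[k] x)

/-- No point of `Ω` is periodic. -/
def IsAperiodic (Ω : Set (ℕ → A)) : Prop := ∀ x ∈ Ω, x ∉ Function.periodicPts (shift (A := A))

/-- Left extensions of `w` in the language. -/
def leftExtensions (Ω : Set (ℕ → A)) (w : List A) : Set (List A) :=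
  {w' ∈ languageOf Ω (w.length + 1) | w'.tail = w}

/-- Right extensions of `w` in the language. -/
def rightExtensions (Ω : Set (ℕ → A)) (w : List A) : Set (List A) :=
  {w' ∈ languageOf Ω (w.length + 1) | w'.dropLast = w}

/-- `w` is in the language and has at least two left extensions. -/
def IsLeftSpecialWord (Ω : Set (ℕ → A)) (w : List A) : Prop :=
  w ∈ language Ω ∧ (leftExtensions Ω w).Nontrivial

/-- `w` is in the language and has at least two right extensions. -/
def IsRightSpecialWord (Ω : Set (ℕ → A)) (w : List A) : Prop :=
  w ∈ language Ω ∧ (rightExtensions Ω w).Nontrivial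

/-- The number of left special words of length `n`. -/
noncomputable def leftCount (Ω : Set (ℕ → A)) (n : ℕ) : ℕ :=
  {w : List A | IsLeftSpecialWord Ω w ∧ w.length = n}.ncard

/-- The number of right special words of length `n`. -/
noncomputable def rightCount (Ω : Set (ℕ → A)) (n : ℕ) : ℕ :=
  {w : List A | IsRightSpecialWord Ω w ∧ w.length = n}.ncard

end Words

section Graphs

/-- Directed graphs in which parallel edges and self-loops are allowed. -/
structure MultiDigraph where
  /-- vertices -/
  V : Type u
  /-- edges -/
  E : Type u
  /-- initial vertex of an edge -/
  src : E → V
  /-- terminal vertex of an edge -/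
  tgt : E → V

/-- There is an edge `a → b`. -/
def MultiDigraph.Adj (G : MultiDigraph.{u}) (a b : G.V) : Prop := ∃ e, G.src e = a ∧ G.tgt e = b

/-- The vertex has more than one incoming edge. -/
def MultiDigraph.IsLeftSpecial (G : MultiDigraph.{u}) (a : G.V) : Prop :=
  {e | G.tgt e = a}.Nontrivial

/-- The vertex has more than one outgoing edge. -/
def MultiDigraph.IsRightSpecial (G : MultiDigraph.{u}) (a : G.V) : Prop :=
  {e | G.src e = a}.Nontrivial

/-- Isomorphisms of directed multigraphs. -/
structure MultiDigraph.Iso (G : MultiDigraph.{u}) (H : MultiDigraph.{v}) where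
  /-- the bijection on vertices -/
  vert : G.V ≃ H.V
  /-- the bijection on edges -/
  edge : G.E ≃ H.E
  src_edge : ∀ e, H.src (edge e) = vert (G.src e)
  tgt_edge : ∀ e, H.tgt (edge e) = vert (G.tgt e)

variable {A : Type u}

/-- Edges `s → t` of the Rauzy graph of order `n`, whose vertices are the words of length `n`. -/
def RauzyEdge (Ω : Set (ℕ → A)) (n : ℕ) (s t : List A) : Prop :=
  ∃ w ∈ languageOf Ω (n + 1), w.dropLast = s ∧ w.tail = t

/-- Vertices of the special Rauzy graph of order `n`. The constructor `left w` is available for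
every left special `w`, the constructor `right w` for every right special `w`. So a word that is
special on one side only gives exactly one vertex, and a bispecial word `w` gives the two
vertices `left w` (that is, `w_ℓ`) and `right w` (that is, `w_r`). -/
inductive SpecVertex (Ω : Set (ℕ → A)) (n : ℕ) : Type u where
  | left (w : List A) (special : IsLeftSpecialWord Ω w) (length_eq : w.length = n)
  | right (w : List A) (special : IsRightSpecialWord Ω w) (length_eq : w.length = n)

/-- The word that underlies a vertex. -/
def SpecVertex.word {Ω : Set (ℕ → A)} {n : ℕ} : SpecVertex Ω n → List A
  | .left w _ _ => w
  | .right w _ _ => w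

/-- Paths of positive length in the Rauzy graph of order `n` that join two special words and visit
only non-special words in between. -/
structure SpecialPath (Ω : Set (ℕ → A)) (n : ℕ) : Type u where
  /-- first word of the path -/
  start : List A
  /-- words strictly between the first one and the last one -/
  inner : List (List A)
  /-- last word of the path -/
  finish : List A
  start_length : start.length = n
  finish_length : finish.length = n
  start_special : IsLeftSpecialWord Ω start ∨ IsRightSpecialWord Ω start
  finish_special : IsLeftSpecialWord Ω finish ∨ IsRightSpecialWord Ω finish
  inner_not_special : ∀ w ∈ inner, ¬ IsLeftSpecialWord Ω w ∧ ¬ IsRightSpecialWord Ω w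
  chain : List.IsChain (RauzyEdge Ω n) (start :: (inner ++ [finish]))

/-- Bispecial words of length `n`. -/
structure BispecialWord (Ω : Set (ℕ → A)) (n : ℕ) : Type u where
  /-- the word -/
  word : List A
  length_eq : word.length = n
  left_special : IsLeftSpecialWord Ω word
  right_special : IsRightSpecialWord Ω word

open Classical in
/-- The vertex at which the edge of a path begins: `right w` if the path begins at a word `w` that
is right special (in particular if `w` is bispecial), and `left w` otherwise. -/
noncomputable def SpecialPath.source {Ω : Set (ℕ → A)} {n : ℕ} (p : SpecialPath Ω n) :
    SpecVertex Ω n :=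
  if h : IsRightSpecialWord Ω p.start then .right p.start h p.start_length
  else .left p.start (p.start_special.resolve_right h) p.start_length

open Classical in
/-- The vertex at which the edge of a path ends: `left w` if the path ends at a word `w` that
is left special (in particular if `w` is bispecial), and `right w` otherwise. -/
noncomputable def SpecialPath.target {Ω : Set (ℕ → A)} {n : ℕ} (p : SpecialPath Ω n) :
    SpecVertex Ω n :=
  if h : IsLeftSpecialWord Ω p.finish then .left p.finish h p.finish_length
  else .right p.finish (p.finish_special.resolve_left h) p.finish_length

/-- The (unweighted) special Rauzy graph of order `n`. Its edges are the paths between special words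
through non-special words, and one further edge `w_ℓ → w_r` for each bispecial word `w`. -/
noncomputable def specialRauzyGraph (Ω : Set (ℕ → A)) (n : ℕ) : MultiDigraph.{u} where
  V := SpecVertex Ω n
  E := SpecialPath Ω n ⊕ BispecialWord Ω n
  src := Sum.elim SpecialPath.source fun w => .left w.word w.left_special w.length_eq
  tgt := Sum.elim SpecialPath.target fun w => .right w.word w.right_special w.length_eq

end Graphs

section Density

variable {A : Type u}

open Classical in
/-- `1` if `w` begins in the `j`-th block of length `L * |w|` of `x` (blocks are numbered from `0`),
and `0` otherwise. -/
noncomputable def blockIndicator (L : ℕ) (w : List A) (x : ℕ → A) (j : ℕ) : ℕ :=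
  if ∃ i, j * (L * w.length) ≤ i ∧ i < (j + 1) * (L * w.length) ∧ OccursAt w x i then 1 else 0

/-- The proportion of the first `N` blocks in which `w` begins. -/
noncomputable def blockAverage (L N : ℕ) (w : List A) (x : ℕ → A) : ℝ :=
  (∑ j ∈ Finset.range N, (blockIndicator L w x j : ℝ)) / N

/-- The disjoint upper density of `w` in `x` by `L`-blocks. -/
noncomputable def wordDensity (L : ℕ) (w : List A) (x : ℕ → A) : ℝ :=
  limsup (fun N : ℕ => blockAverage L N w x) atTop

/-- The disjoint upper `L`-density, in the point `x`, of the measure generated by the sequence of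
words `w n`, where `n` runs through `J`. -/
noncomputable def disjointDensity (L : ℕ) {J : Set ℕ} (w : J → List A) (x : ℕ → A) : ℝ :=
  limsup (fun n : J => wordDensity L (w n) x) atTop

end Density

section Measures

variable {A : Type u} [MeasurableSpace A]

/-- Shift-invariant probability measures on `Ω`, seen as measures on the full shift. -/
structure IsInvariantMeasure (Ω : Set (ℕ → A)) (μ : Measure (ℕ → A)) : Prop where
  isProbabilityMeasure : IsProbabilityMeasure μ
  measurePreserving : MeasurePreserving shift μ μ
  measure_compl : μ Ωᶜ = 0

/-- Ergodic shift-invariant probability measures on `Ω`. -/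
structure IsErgodicMeasure (Ω : Set (ℕ → A)) (ν : Measure (ℕ → A)) : Prop
    extends IsInvariantMeasure Ω ν where
  ergodic : Ergodic shift ν

/-- The point `x` is generic for `ν`. -/
def IsGeneric (x : ℕ → A) (ν : Measure (ℕ → A)) : Prop :=
  ∀ s : List A, Tendsto (fun n : ℕ => (occurrences s (factor x 0 n) : ℝ) / n) atTop
    (𝓝 (ν.real (wordCylinder s)))

/-- The words `w n` generate the invariant measure `μ` on `Ω` as `n → ∞` in `J`. -/
structure Generates (Ω : Set (ℕ → A)) {J : Set ℕ} (w : J → List A) (μ : Measure (ℕ → A)) :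
    Prop where
  mem_language : ∀ n, w n ∈ language Ω
  isInvariantMeasure : IsInvariantMeasure Ω μ
  tendsto : ∀ s : List A,
    Tendsto (fun n : J => (occurrences s (w n) : ℝ) / (w n).length) atTop
      (𝓝 (μ.real (wordCylinder s)))

/-- A limiting unweighted special Rauzy graph `Λ` of `Ω`, with the choices that belong to it. -/
structure LimitGraph (Ω : Set (ℕ → A)) (K : ℕ) where
  /-- the orders `n` that are considered -/
  J : Set ℕ
  pos_of_mem : ∀ n ∈ J, 0 < n
  infinite : J.Infinite
  /-- the number of left special words -/
  Kl : ℕ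
  /-- the number of right special words -/
  Kr : ℕ
  Kl_le : Kl ≤ K
  Kr_le : Kr ≤ K
  leftCount_eq : ∀ n ∈ J, leftCount Ω n = Kl
  rightCount_eq : ∀ n ∈ J, rightCount Ω n = Kr
  /-- the common unweighted graph -/
  Λ : MultiDigraph.{v}
  /-- the identification of `Λ` with the special Rauzy graph of order `n` -/
  iso : ∀ n : J, Λ.Iso (specialRauzyGraph Ω n)
  /-- the limit measures of the vertices -/
  μ : Λ.V → Measure (ℕ → A)
  generates : ∀ a : Λ.V, Generates Ω (fun n : J => SpecVertex.word ((iso n).vert a)) (μ a)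

/-- The word of length `n` that the vertex `a` of the limit graph stands for. -/
def LimitGraph.word {Ω : Set (ℕ → A)} {K : ℕ} (D : LimitGraph.{u, v} Ω K) (a : D.Λ.V) (n : D.J) :
    List A :=
  SpecVertex.word ((D.iso n).vert a)

/-- The vertex `a` is colored by the ergodic measure `ν`: its limit measure has positive disjoint
upper `(K + 1)`-density in `ν`. Here `x ν` is the chosen generic point of `ν`. -/
def LimitGraph.Colored {Ω : Set (ℕ → A)} {K : ℕ} (D : LimitGraph.{u, v} Ω K)
    (x : Measure (ℕ → A) → ℕ → A) (a : D.Λ.V) (ν : Measure (ℕ → A)) : Prop :=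
  IsErgodicMeasure Ω ν ∧ 0 < disjointDensity (K + 1) (D.word a) (x ν)

end Measures

end SpecialRauzy

open SpecialRauzy

/-! A vertex can only be colored by its own limit measure. Suppose words `w` of length `n` begin in
a proportion more than `c` of the `L`-blocks of a point generic for `ν`. Counting a word `s` inside
these occurrences of `w`, each of which meets at most two blocks, gives c · |w|_s ≤ 2Ln · ν([s]),
and in the limit c · μ([s]) ≤ 2L · ν([s]) (`mul_real_wordCylinder_le`). A bound on cylinders passes
to open sets, then outer regularity yields μ ≪ ν, and ergodicity of ν forces μ = ν
(`eq_of_disjointDensity_pos`).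

The existence statements rest on p(n) < (K+1)n for large n. A window with more than p(n) positions
repeats a word. If no word in it were right special, the orbit would cycle between the two
repetitions forever and never meet a right special word, against minimality and aperiodicity; for
left special words the same argument runs backwards. Hence every `L`-block sees special words of
both kinds, and the path that the orbit follows from one special word to the next is an edge of the
special Rauzy graph, of length at most Ln (`exists_adj_before`, `exists_adj_after`).

So left special vertices, right special vertices and the neighbors of a colored vertex occur in, or
close to, a positive proportion of blocks. The graph is finite, so by pigeonhole, first in the
number of blocks and then in `n`, one fixed vertex of the required kind has positive upper density
(`exists_disjointDensity_pos_of_cover`). The unique neighbor on the non-branching side must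
therefore carry the color, and some neighbor on the branching side does. -/

namespace SpecialRauzy

/-! ### Special words and their recurrence. -/

section Combinatorics

variable {A : Type u}

@[simp] lemma length_factor (x : ℕ → A) (i n : ℕ) : (factor x i n).length = n := by
  simp [factor]

@[simp] lemma getElem_factor (x : ℕ → A) (i n k : ℕ) (h : k < (factor x i n).length) :
    (factor x i n)[k] = x (i + k) := by
  simp [factor]

lemma factor_eq_iff {x y : ℕ → A} {i j n : ℕ} :
    factor x i n = factor y j n ↔ ∀ k < n, x (i + k) = y (j + k) := by
  constructor
  · intro h k hk
    have h1 := getElem_factor x i n k (by simpa using hk)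
    have h2 := getElem_factor y j n k (by simpa using hk)
    rw [← h1, ← h2]
    simp [h]
  · intro h
    apply List.ext_getElem (by simp)
    intro k h1 h2
    rw [getElem_factor, getElem_factor]
    exact h k (by simpa using h1)

lemma occursAt_iff {w : List A} {x : ℕ → A} {i : ℕ} :
    OccursAt w x i ↔ ∀ k (h : k < w.length), x (i + k) = w[k] := by
  constructor
  · intro h k hk
    have h1 := getElem_factor x i w.length k (by simpa using hk)
    rw [← h1]
    congr 1
  · intro h
    apply List.ext_getElem (by simp)
    intro k h1 h2
    rw [getElem_factor]
    exact h k h2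

lemma occursAt_factor (x : ℕ → A) (i n : ℕ) : OccursAt (factor x i n) x i := by
  simp [OccursAt]

lemma OccursAt.factor_eq {w : List A} {x : ℕ → A} {i n : ℕ} (h : OccursAt w x i)
    (hn : w.length = n) : factor x i n = w := by
  subst hn; exact h

lemma tail_factor (x : ℕ → A) (i n : ℕ) : (factor x i (n + 1)).tail = factor x (i + 1) n := by
  apply List.ext_getElem (by simp)
  intro k h1 h2
  simp only [List.getElem_tail, getElem_factor]
  congr 1; omega

lemma dropLast_factor (x : ℕ → A) (i n : ℕ) : (factor x i (n + 1)).dropLast = factor x i n := by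
  apply List.ext_getElem (by simp)
  intro k h1 h2
  simp only [List.getElem_dropLast, getElem_factor]

lemma iterate_shift_apply (x : ℕ → A) (k m : ℕ) : shift^[k] x m = x (m + k) := by
  induction k generalizing m with
  | zero => rfl
  | succ k ih =>
    rw [Function.iterate_succ_apply']
    change shift^[k] x (m + 1) = _
    rw [ih]; congr 1; omega

lemma factor_iterate_shift (x : ℕ → A) (k i n : ℕ) :
    factor (shift^[k] x) i n = factor x (i + k) n := by
  rw [factor_eq_iff]
  intro m _
  rw [iterate_shift_apply]; congr 1; omega

lemma factor_mem_languageOf {Ω : Set (ℕ → A)} {x : ℕ → A} (hx : x ∈ Ω) (i n : ℕ) :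
    factor x i n ∈ languageOf Ω n :=
  ⟨⟨x, hx, i, occursAt_factor x i n⟩, length_factor x i n⟩

lemma mem_languageOf_iff {Ω : Set (ℕ → A)} {w : List A} {n : ℕ} :
    w ∈ languageOf Ω n ↔ ∃ x ∈ Ω, ∃ i, factor x i n = w := by
  constructor
  · rintro ⟨⟨x, hx, i, hi⟩, hn⟩
    exact ⟨x, hx, i, hi.factor_eq hn⟩
  · rintro ⟨x, hx, i, rfl⟩
    exact factor_mem_languageOf hx i n

lemma finite_languageOf [Finite A] (Ω : Set (ℕ → A)) (n : ℕ) : (languageOf Ω n).Finite :=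
  (List.finite_length_eq A n).subset fun _ h => h.2

lemma isLeftSpecialWord_of_ne {Ω : Set (ℕ → A)} {n : ℕ} {a b : List A}
    (ha : a ∈ languageOf Ω (n + 1)) (hb : b ∈ languageOf Ω (n + 1)) (hne : a ≠ b)
    (h : a.tail = b.tail) : IsLeftSpecialWord Ω a.tail := by
  have hl : a.tail.length + 1 = n + 1 := by simp [ha.2]
  refine ⟨?_, a, ⟨hl ▸ ha, rfl⟩, b, ⟨hl ▸ hb, h.symm⟩, hne⟩
  obtain ⟨x, hx, i, rfl⟩ := mem_languageOf_iff.1 ha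
  rw [tail_factor]
  exact (factor_mem_languageOf hx _ _).1

lemma isRightSpecialWord_of_ne {Ω : Set (ℕ → A)} {n : ℕ} {a b : List A}
    (ha : a ∈ languageOf Ω (n + 1)) (hb : b ∈ languageOf Ω (n + 1)) (hne : a ≠ b)
    (h : a.dropLast = b.dropLast) : IsRightSpecialWord Ω a.dropLast := by
  have hl : a.dropLast.length + 1 = n + 1 := by simp [ha.2]
  refine ⟨?_, a, ⟨hl ▸ ha, rfl⟩, b, ⟨hl ▸ hb, h.symm⟩, hne⟩
  obtain ⟨x, hx, i, rfl⟩ := mem_languageOf_iff.1 ha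
  rw [dropLast_factor]
  exact (factor_mem_languageOf hx _ _).1

lemma factor_eq_of_not_leftSpecial {Ω : Set (ℕ → A)} {x y : ℕ → A} (hx : x ∈ Ω) (hy : y ∈ Ω)
    {i j n : ℕ} (hs : ¬ IsLeftSpecialWord Ω (factor x (i + 1) n))
    (h : factor x (i + 1) n = factor y (j + 1) n) : factor x i n = factor y j n := by
  rw [← dropLast_factor x, ← dropLast_factor y]
  congr 1
  by_contra hne
  refine hs ?_
  rw [← tail_factor]
  exact isLeftSpecialWord_of_ne (factor_mem_languageOf hx i (n + 1))
    (factor_mem_languageOf hy j (n + 1)) hne (by rw [tail_factor, tail_factor, h])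

lemma factor_succ_length_eq_of_not_rightSpecial {Ω : Set (ℕ → A)} {x y : ℕ → A} (hx : x ∈ Ω)
    (hy : y ∈ Ω) {i j n : ℕ} (hs : ¬ IsRightSpecialWord Ω (factor x i n))
    (h : factor x i n = factor y j n) : factor x i (n + 1) = factor y j (n + 1) := by
  by_contra hne
  refine hs ?_
  rw [← dropLast_factor]
  exact isRightSpecialWord_of_ne (factor_mem_languageOf hx i (n + 1))
    (factor_mem_languageOf hy j (n + 1)) hne (by rw [dropLast_factor, dropLast_factor, h])

lemma factor_eq_of_not_rightSpecial {Ω : Set (ℕ → A)} {x y : ℕ → A} (hx : x ∈ Ω)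
    (hy : y ∈ Ω) {i j n : ℕ} (hs : ¬ IsRightSpecialWord Ω (factor x i n))
    (h : factor x i n = factor y j n) : factor x (i + 1) n = factor y (j + 1) n := by
  rw [← tail_factor, ← tail_factor, factor_succ_length_eq_of_not_rightSpecial hx hy hs h]

lemma image_dropLast_languageOf (Ω : Set (ℕ → A)) (n : ℕ) :
    List.dropLast '' languageOf Ω (n + 1) = languageOf Ω n := by
  ext w
  simp only [Set.mem_image, mem_languageOf_iff]
  constructor
  · rintro ⟨_, ⟨x, hx, i, rfl⟩, rfl⟩
    exact ⟨x, hx, i, (dropLast_factor x i n).symm⟩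
  · rintro ⟨x, hx, i, rfl⟩
    exact ⟨_, ⟨x, hx, i, rfl⟩, dropLast_factor x i n⟩

lemma image_tail_languageOf_subset (Ω : Set (ℕ → A)) (n : ℕ) :
    List.tail '' languageOf Ω (n + 1) ⊆ languageOf Ω n := by
  rintro _ ⟨w, hw, rfl⟩
  obtain ⟨x, hx, i, rfl⟩ := mem_languageOf_iff.1 hw
  rw [tail_factor]
  exact factor_mem_languageOf hx _ _

/-- In an aperiodic system there are right special words of every length. -/
lemma exists_rightSpecial [Finite A] {Ω : Set (ℕ → A)} (hne : Ω.Nonempty)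
    (hmaps : Set.MapsTo shift Ω Ω) (haper : IsAperiodic Ω) (n : ℕ) :
    ∃ w, IsRightSpecialWord Ω w ∧ w.length = n := by
  by_contra! hno
  obtain ⟨x, hx⟩ := hne
  have hno' : ∀ i, ¬ IsRightSpecialWord Ω (factor x i n) := fun i h => hno _ h (by simp)
  -- Finitely many words force a repetition; without right special words it propagates to the right
  -- and makes a tail of `x` periodic.
  have hnotinj : ¬ Function.Injective fun i : ℕ => (⟨factor x i n, factor_mem_languageOf hx i n⟩ :
      languageOf Ω n) := by
    have := (finite_languageOf Ω n).to_subtype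
    exact not_injective_infinite_finite _
  obtain ⟨i, j, hij, hlt⟩ : ∃ i j, factor x i n = factor x j n ∧ i < j := by
    simp only [Function.Injective, not_forall, Subtype.mk.injEq] at hnotinj
    obtain ⟨i, j, h, hne⟩ := hnotinj
    rcases lt_or_gt_of_ne hne with h' | h'
    · exact ⟨i, j, h, h'⟩
    · exact ⟨j, i, h.symm, h'⟩
  have hall : ∀ k, factor x (i + k) n = factor x (j + k) n := by
    intro k
    induction k with
    | zero => exact hij
    | succ k ih => exact factor_eq_of_not_rightSpecial hx hx (hno' _) ih
  -- The last letter of the word of length `n + 1` is compared, so that the case `n = 0`, where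
  -- words of length `n` say nothing, is covered.
  have hval : ∀ k, x (i + k + n) = x (j + k + n) := fun k =>
    factor_eq_iff.1 (factor_succ_length_eq_of_not_rightSpecial hx hx (hno' _) (hall k)) n
      (Nat.lt_succ_self n)
  refine haper (shift^[i + n] x) (hmaps.iterate _ hx) ⟨j - i, by omega, ?_⟩
  funext m
  rw [iterate_shift_apply, iterate_shift_apply, iterate_shift_apply]
  have := hval m
  rw [show m + (j - i) + (i + n) = j + m + n by omega, show m + (i + n) = i + m + n by omega, this]

/-- `List.dropLast` maps the words of length `n + 1` onto those of length `n`; without growth it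
would be injective, which a right special word forbids. -/
lemma complexity_lt_succ [Finite A] {Ω : Set (ℕ → A)} (hne : Ω.Nonempty)
    (hmaps : Set.MapsTo shift Ω Ω) (haper : IsAperiodic Ω) (n : ℕ) :
    complexity Ω n < complexity Ω (n + 1) := by
  by_contra! hle
  obtain ⟨w, ⟨-, a, ha, b, hb, hab⟩, hn⟩ := exists_rightSpecial hne hmaps haper n
  have hinj : Set.InjOn List.dropLast (languageOf Ω (n + 1)) := by
    rw [← Set.ncard_image_iff (finite_languageOf Ω _)]
    refine le_antisymm (Set.ncard_image_le (finite_languageOf Ω _)) ?_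
    rw [image_dropLast_languageOf]
    exact hle
  subst hn
  exact hab (hinj ha.1 hb.1 (ha.2.trans hb.2.symm))

/-- Since the complexity grows, `List.tail` cannot be injective on the words of length `n + 1`; two
words with the same tail exhibit a left special word. -/
lemma exists_leftSpecial [Finite A] {Ω : Set (ℕ → A)} (hne : Ω.Nonempty)
    (hmaps : Set.MapsTo shift Ω Ω) (haper : IsAperiodic Ω) (n : ℕ) :
    ∃ w, IsLeftSpecialWord Ω w ∧ w.length = n := by
  have hnot : ¬ Set.InjOn List.tail (languageOf Ω (n + 1)) := by
    intro hinj
    have h1 := hinj.ncard_image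
    have h2 := Set.ncard_le_ncard (image_tail_languageOf_subset Ω n) (finite_languageOf Ω n)
    have h3 := complexity_lt_succ hne hmaps haper n
    unfold complexity at h3
    omega
  simp only [Set.InjOn, not_forall] at hnot
  obtain ⟨a, ha, b, hb, h, hab⟩ := hnot
  exact ⟨a.tail, isLeftSpecialWord_of_ne ha hb hab h, by simp [ha.2]⟩

/-- The complexity is affine with slope `K` from `N₀` on. This is why blocks of length (K+1)n are
long enough. -/
lemma eventually_complexity_lt {Ω : Set (ℕ → A)} {K N₀ : ℕ}
    (hK : ∀ n ≥ N₀, complexity Ω (n + 1) = complexity Ω n + K) :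
    ∀ᶠ n in atTop, complexity Ω n < (K + 1) * n := by
  have h : ∀ m, complexity Ω (N₀ + m) = complexity Ω N₀ + K * m := by
    intro m
    induction m with
    | zero => simp
    | succ m ih => rw [← add_assoc, hK _ (by omega), ih]; ring
  filter_upwards [eventually_ge_atTop (N₀ + complexity Ω N₀ + 1)] with n hn
  obtain ⟨m, rfl⟩ := Nat.exists_eq_add_of_le (show N₀ ≤ n by omega)
  rw [h]
  nlinarith

lemma isOpen_wordCylinder [TopologicalSpace A] [DiscreteTopology A] (w : List A) :
    IsOpen (wordCylinder w) := by
  have : wordCylinder w = ⋂ k : Fin w.length, {x : ℕ → A | x k = w[k]} := by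
    ext x
    simp only [wordCylinder, Set.mem_ofPred_eq, occursAt_iff, zero_add, Set.mem_iInter]
    exact ⟨fun h k => h k k.2, fun h k hk => h ⟨k, hk⟩⟩
  rw [this]
  refine isOpen_iInter_of_finite fun k => ?_
  exact (isOpen_discrete {w[k]}).preimage (continuous_apply (A := fun _ : ℕ => A) (k : ℕ))

/-- In a minimal system every word of the language occurs arbitrarily late in every point. -/
lemma IsMinimalShift.exists_factor_eq [TopologicalSpace A] [DiscreteTopology A]
    {Ω : Set (ℕ → A)} (hmin : IsMinimalShift Ω) {x : ℕ → A} (hx : x ∈ Ω) {w : List A} {n : ℕ}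
    (hw : w ∈ languageOf Ω n) (M : ℕ) : ∃ i ≥ M, factor x i n = w := by
  obtain ⟨y, hy, j, rfl⟩ := mem_languageOf_iff.1 hw
  -- Density is applied to the orbit of `shift^[M] x`, which makes the occurrence late.
  have hz : shift^[j] y ∈ closure (Set.range fun k : ℕ => shift^[k] (shift^[M] x)) :=
    hmin.dense_orbit _ (hmin.mapsTo.iterate M hx) (hmin.mapsTo.iterate j hy)
  have hmem : shift^[j] y ∈ wordCylinder (factor y j n) := by
    change factor _ _ _ = _
    rw [factor_iterate_shift]
    simp
  obtain ⟨_, hz1, k, rfl⟩ := mem_closure_iff.1 hz _ (isOpen_wordCylinder _) hmem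
  refine ⟨k + M, by omega, ?_⟩
  have hz2 := OccursAt.factor_eq hz1 (length_factor y j n)
  beta_reduce at hz2
  rw [factor_iterate_shift, factor_iterate_shift, zero_add] at hz2
  exact hz2

lemma exists_factor_eq_in_window [Finite A] {Ω : Set (ℕ → A)} {x : ℕ → A} (hx : x ∈ Ω)
    {n B : ℕ} (hB : complexity Ω n < B) (i₀ : ℕ) :
    ∃ s t, i₀ ≤ s ∧ s < t ∧ t < i₀ + B ∧ factor x s n = factor x t n := by
  classical
  have hfin := finite_languageOf Ω n
  have hcard : hfin.toFinset.card < (Finset.Ico i₀ (i₀ + B)).card := by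
    rw [← Set.ncard_eq_toFinset_card _ hfin]
    simpa [complexity] using hB
  obtain ⟨s, hs, t, ht, hne, h⟩ := Finset.exists_ne_map_eq_of_card_lt_of_maps_to hcard
    (f := fun i => factor x i n) (fun i _ => by simpa using factor_mem_languageOf hx i n)
  simp only [Finset.mem_Ico] at hs ht
  rcases lt_or_gt_of_ne hne with h' | h'
  · exact ⟨s, t, hs.1, h', ht.2, h⟩
  · exact ⟨t, s, ht.1, h', hs.2, h.symm⟩

/-- A right special word begins in every window that is longer than the number of words. -/
lemma IsMinimalShift.exists_rightSpecial_in_window [Finite A] [TopologicalSpace A]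
    [DiscreteTopology A] {Ω : Set (ℕ → A)} (hmin : IsMinimalShift Ω) (haper : IsAperiodic Ω)
    {x : ℕ → A} (hx : x ∈ Ω) {n B : ℕ} (hB : complexity Ω n < B) (i₀ : ℕ) :
    ∃ i, i₀ ≤ i ∧ i < i₀ + B ∧ IsRightSpecialWord Ω (factor x i n) := by
  by_contra! hno
  obtain ⟨s, t, hs, hst, ht, heq⟩ := exists_factor_eq_in_window hx hB i₀
  have hcyc : ∀ k, ∃ m, s ≤ m ∧ m < t ∧ factor x (s + k) n = factor x m n := by
    intro k
    induction k with
    | zero => exact ⟨s, le_rfl, hst, rfl⟩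
    | succ k ih =>
      obtain ⟨m, h1, h2, h3⟩ := ih
      have h4 := factor_eq_of_not_rightSpecial hx hx
        (by rw [h3]; exact hno m (by omega) (by omega)) h3
      -- On reaching `t` the orbit is sent back to `s`, where the same word begins.
      rcases Nat.lt_or_ge (m + 1) t with h | h
      · exact ⟨m + 1, by omega, h, h4⟩
      · refine ⟨s, le_rfl, hst, ?_⟩
        rw [heq, show t = m + 1 by omega]
        exact h4
  obtain ⟨w, hw, hn⟩ := exists_rightSpecial hmin.nonempty hmin.mapsTo haper n
  obtain ⟨i, hi, rfl⟩ := hmin.exists_factor_eq hx ⟨hw.1, hn⟩ s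
  obtain ⟨m, h1, h2, h3⟩ := hcyc (i - s)
  rw [Nat.add_sub_cancel' hi] at h3
  exact hno m (by omega) (by omega) (h3 ▸ hw)

/-- A left special word begins in every window that is longer than the number of words. -/
lemma IsMinimalShift.exists_leftSpecial_in_window [Finite A] [TopologicalSpace A]
    [DiscreteTopology A] {Ω : Set (ℕ → A)} (hmin : IsMinimalShift Ω) (haper : IsAperiodic Ω)
    {x : ℕ → A} (hx : x ∈ Ω) {n B : ℕ} (hB : complexity Ω n < B) (i₀ : ℕ) :
    ∃ i, i₀ ≤ i ∧ i < i₀ + B ∧ IsLeftSpecialWord Ω (factor x i n) := by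
  by_contra! hno
  obtain ⟨s, t, hs, hst, ht, heq⟩ := exists_factor_eq_in_window hx hB i₀
  have hcyc : ∀ i, factor x i n = factor x s n → ∀ k ≤ i,
      ∃ m, s < m ∧ m ≤ t ∧ factor x (i - k) n = factor x m n := by
    intro i hi k
    induction k with
    | zero => exact fun _ => ⟨t, hst, le_rfl, hi.trans heq⟩
    | succ k ih =>
      intro hk
      obtain ⟨m, h1, h2, h3⟩ := ih (by omega)
      obtain ⟨m, rfl⟩ : ∃ m', m = m' + 1 := ⟨m - 1, by omega⟩
      rw [show i - k = i - (k + 1) + 1 by omega] at h3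
      have h4 := factor_eq_of_not_leftSpecial hx hx
        (by rw [h3]; exact hno (m + 1) (by omega) (by omega)) h3
      -- Going backwards, the position `s` is replaced by `t`.
      rcases Nat.lt_or_ge s m with h | h
      · exact ⟨m, h, by omega, h4⟩
      · refine ⟨t, hst, le_rfl, ?_⟩
        rw [← heq, show s = m by omega]
        exact h4
  obtain ⟨w, hw, hn⟩ := exists_leftSpecial hmin.nonempty hmin.mapsTo haper n
  -- The sequence is one-sided, so the backward run starts at a recurrence `i` of the repeated word
  -- that lies beyond the left special word at `l`.
  obtain ⟨l, -, rfl⟩ := hmin.exists_factor_eq hx ⟨hw.1, hn⟩ 0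
  obtain ⟨i, hi, hi'⟩ := hmin.exists_factor_eq hx (factor_mem_languageOf hx s n) l
  obtain ⟨m, h1, h2, h3⟩ := hcyc i hi' (i - l) (by omega)
  rw [Nat.sub_sub_self hi] at h3
  exact hno m (by omega) (by omega) (h3 ▸ hw)

end Combinatorics

/-! ### Edges of the special Rauzy graph as pieces of an orbit. -/

section GraphStructure

variable {A : Type u} {Ω : Set (ℕ → A)} {n : ℕ}

lemma RauzyEdge.eq_of_not_rightSpecial {s t t' : List A} (hs : ¬ IsRightSpecialWord Ω s)
    (h : RauzyEdge Ω n s t) (h' : RauzyEdge Ω n s t') : t = t' := by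
  obtain ⟨w, hw, h1, h2⟩ := h
  obtain ⟨w', hw', h1', h2'⟩ := h'
  by_contra hne
  have hww : w ≠ w' := fun e => hne (by rw [← h2, ← h2', e])
  exact hs (h1 ▸ isRightSpecialWord_of_ne hw hw' hww (h1.trans h1'.symm))

lemma RauzyEdge.eq_of_not_leftSpecial {s s' t : List A} (ht : ¬ IsLeftSpecialWord Ω t)
    (h : RauzyEdge Ω n s t) (h' : RauzyEdge Ω n s' t) : s = s' := by
  obtain ⟨w, hw, h1, h2⟩ := h
  obtain ⟨w', hw', h1', h2'⟩ := h'
  by_contra hne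
  have hww : w ≠ w' := fun e => hne (by rw [← h1, ← h1', e])
  exact ht (h2 ▸ isLeftSpecialWord_of_ne hw hw' hww (h2.trans h2'.symm))

/-- A chain from `a` to the first visit to `P` is unique if the relation is deterministic at `a`
and outside of `P`. -/
lemma isChain_first_visit_unique {α : Type*} {R : α → α → Prop} {P : α → Prop}
    (hR : ∀ b, ¬ P b → ∀ y y', R b y → R b y' → y = y') {a z z' : α} {l l' : List α}
    (ha : ∀ y y', R a y → R a y' → y = y')
    (hl : ∀ b ∈ l, ¬ P b) (hl' : ∀ b ∈ l', ¬ P b) (hz : P z) (hz' : P z')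
    (hc : List.IsChain R (a :: (l ++ [z]))) (hc' : List.IsChain R (a :: (l' ++ [z']))) :
    l = l' ∧ z = z' := by
  induction l generalizing a l' with
  | nil =>
    cases l' with
    | nil => simpa using ha z z' (by simpa using hc) (by simpa using hc')
    | cons b l' =>
      simp only [List.nil_append, List.cons_append, List.isChain_cons_cons] at hc hc'
      exact absurd (ha z b hc.1 hc'.1 ▸ hz) (hl' b (by simp))
  | cons b l ih =>
    cases l' with
    | nil =>
      simp only [List.nil_append, List.cons_append, List.isChain_cons_cons] at hc hc'
      exact absurd (ha z' b hc'.1 hc.1 ▸ hz') (hl b (by simp))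
    | cons b' l' =>
      simp only [List.cons_append, List.isChain_cons_cons] at hc hc'
      obtain rfl := ha b b' hc.1 hc'.1
      obtain ⟨h1, h2⟩ := ih (hR b (hl b (by simp))) (fun c hc => hl c (by simp [hc]))
        (fun c hc => hl' c (by simp [hc])) hc.2 hc'.2
      exact ⟨by rw [h1], h2⟩

lemma SpecialPath.eq_of_eq {p q : SpecialPath Ω n} (h1 : p.start = q.start)
    (h2 : p.inner = q.inner) (h3 : p.finish = q.finish) : p = q := by
  cases p; cases q
  simp only at h1 h2 h3
  subst h1 h2 h3
  rfl

/-- Neither the first word nor the inner words are right special, so every step of the path is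
forced until it meets a special word. -/
lemma SpecialPath.eq_of_start_eq {p q : SpecialPath Ω n} (h : p.start = q.start)
    (hs : ¬ IsRightSpecialWord Ω p.start) : p = q := by
  obtain ⟨h1, h2⟩ := isChain_first_visit_unique
    (R := RauzyEdge Ω n)
    (P := fun w => IsLeftSpecialWord Ω w ∨ IsRightSpecialWord Ω w)
    (fun b hb y y' => RauzyEdge.eq_of_not_rightSpecial fun h => hb (Or.inr h))
    (fun y y' => RauzyEdge.eq_of_not_rightSpecial hs)
    (fun b hb => not_or.2 (p.inner_not_special b hb))
    (fun b hb => not_or.2 (q.inner_not_special b hb)) p.finish_special q.finish_special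
    p.chain (h ▸ q.chain)
  exact eq_of_eq h h1 h2

lemma SpecialPath.chain_reverse (p : SpecialPath Ω n) :
    List.IsChain (fun s t => RauzyEdge Ω n t s) (p.finish :: (p.inner.reverse ++ [p.start])) := by
  have := List.isChain_reverse.2 p.chain
  simpa using this

lemma SpecialPath.eq_of_finish_eq {p q : SpecialPath Ω n} (h : p.finish = q.finish)
    (hs : ¬ IsLeftSpecialWord Ω p.finish) : p = q := by
  obtain ⟨h1, h2⟩ := isChain_first_visit_unique
    (R := fun s t => RauzyEdge Ω n t s)
    (P := fun w => IsLeftSpecialWord Ω w ∨ IsRightSpecialWord Ω w)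
    (fun b hb y y' => RauzyEdge.eq_of_not_leftSpecial fun h => hb (Or.inl h))
    (fun y y' => RauzyEdge.eq_of_not_leftSpecial hs)
    (fun b hb => not_or.2 (p.inner_not_special b (List.mem_reverse.1 hb)))
    (fun b hb => not_or.2 (q.inner_not_special b (List.mem_reverse.1 hb)))
    p.start_special q.start_special p.chain_reverse (h ▸ q.chain_reverse)
  exact eq_of_eq h2 (List.reverse_injective h1) h

lemma SpecialPath.word_source (p : SpecialPath Ω n) : p.source.word = p.start := by
  unfold source
  split_ifs <;> rfl

lemma SpecialPath.word_target (p : SpecialPath Ω n) : p.target.word = p.finish := by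
  unfold target
  split_ifs <;> rfl

lemma SpecialPath.source_eq_right {p : SpecialPath Ω n} {w : List A}
    {hs : IsRightSpecialWord Ω w} {hl : w.length = n} (h : p.start = w) :
    p.source = .right w hs hl := by
  subst h
  simp [source, hs]

lemma SpecialPath.source_eq_left {p : SpecialPath Ω n} {w : List A}
    {hs : IsLeftSpecialWord Ω w} {hl : w.length = n} (h : p.start = w)
    (hr : ¬ IsRightSpecialWord Ω w) : p.source = .left w hs hl := by
  subst h
  simp [source, hr]

lemma SpecialPath.target_eq_left {p : SpecialPath Ω n} {w : List A}
    {hs : IsLeftSpecialWord Ω w} {hl : w.length = n} (h : p.finish = w) :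
    p.target = .left w hs hl := by
  subst h
  simp [target, hs]

lemma SpecialPath.target_eq_right {p : SpecialPath Ω n} {w : List A}
    {hs : IsRightSpecialWord Ω w} {hl : w.length = n} (h : p.finish = w)
    (hr : ¬ IsLeftSpecialWord Ω w) : p.target = .right w hs hl := by
  subst h
  simp [target, hr]

lemma SpecialPath.of_source_eq_left {p : SpecialPath Ω n} {w : List A}
    {hs : IsLeftSpecialWord Ω w} {hl : w.length = n} (h : p.source = .left w hs hl) :
    p.start = w ∧ ¬ IsRightSpecialWord Ω w := by
  have h1 : p.start = w := by rw [← p.word_source, h]; rfl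
  refine ⟨h1, fun hr => ?_⟩
  rw [source_eq_right (hs := hr) (hl := hl) h1] at h
  cases h

lemma SpecialPath.of_target_eq_right {p : SpecialPath Ω n} {w : List A}
    {hs : IsRightSpecialWord Ω w} {hl : w.length = n} (h : p.target = .right w hs hl) :
    p.finish = w ∧ ¬ IsLeftSpecialWord Ω w := by
  have h1 : p.finish = w := by rw [← p.word_target, h]; rfl
  refine ⟨h1, fun hr => ?_⟩
  rw [target_eq_left (hs := hr) (hl := hl) h1] at h
  cases h

lemma BispecialWord.eq_of_word_eq {b c : BispecialWord Ω n} (h : b.word = c.word) : b = c := by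
  cases b; cases c; simp only at h; subst h; rfl

/-- A vertex `left w` has at most one outgoing edge. -/
lemma outgoing_left_subsingleton {w : List A} (hs : IsLeftSpecialWord Ω w) (hl : w.length = n) :
    {e | (specialRauzyGraph Ω n).src e = SpecVertex.left w hs hl}.Subsingleton := by
  -- If `w` is bispecial, all paths leave from its `right` copy and only the extra edge leaves `left
  -- w`; otherwise only one path starts at `w`. The mixed cases contradict each other.
  rintro (p | b) hp (q | c) hq
  · obtain ⟨h1, h2⟩ := SpecialPath.of_source_eq_left hp
    obtain ⟨h3, -⟩ := SpecialPath.of_source_eq_left hq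
    rw [SpecialPath.eq_of_start_eq (h1.trans h3.symm) (h1 ▸ h2)]
  · obtain ⟨-, h2⟩ := SpecialPath.of_source_eq_left hp
    have h3 : c.word = w := congrArg SpecVertex.word hq
    exact absurd (h3 ▸ c.right_special) h2
  · obtain ⟨-, h2⟩ := SpecialPath.of_source_eq_left hq
    have h3 : b.word = w := congrArg SpecVertex.word hp
    exact absurd (h3 ▸ b.right_special) h2
  · have h3 : b.word = w := congrArg SpecVertex.word hp
    have h4 : c.word = w := congrArg SpecVertex.word hq
    rw [BispecialWord.eq_of_word_eq (h3.trans h4.symm)]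

/-- A vertex `right w` has at most one incoming edge. -/
lemma incoming_right_subsingleton {w : List A} (hs : IsRightSpecialWord Ω w) (hl : w.length = n) :
    {e | (specialRauzyGraph Ω n).tgt e = SpecVertex.right w hs hl}.Subsingleton := by
  rintro (p | b) hp (q | c) hq
  · obtain ⟨h1, h2⟩ := SpecialPath.of_target_eq_right hp
    obtain ⟨h3, -⟩ := SpecialPath.of_target_eq_right hq
    rw [SpecialPath.eq_of_finish_eq (h1.trans h3.symm) (h1 ▸ h2)]
  · obtain ⟨-, h2⟩ := SpecialPath.of_target_eq_right hp
    have h3 : c.word = w := congrArg SpecVertex.word hq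
    exact absurd (h3 ▸ c.left_special) h2
  · obtain ⟨-, h2⟩ := SpecialPath.of_target_eq_right hq
    have h3 : b.word = w := congrArg SpecVertex.word hp
    exact absurd (h3 ▸ b.left_special) h2
  · have h3 : b.word = w := congrArg SpecVertex.word hp
    have h4 : c.word = w := congrArg SpecVertex.word hq
    rw [BispecialWord.eq_of_word_eq (h3.trans h4.symm)]

lemma adj_unique_of_isRightSpecial {b c c' : (specialRauzyGraph Ω n).V}
    (hb : (specialRauzyGraph Ω n).IsRightSpecial b) (h : (specialRauzyGraph Ω n).Adj c b)
    (h' : (specialRauzyGraph Ω n).Adj c' b) : c = c' := by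
  obtain ⟨e, he1, he2⟩ := h
  obtain ⟨e', he1', he2'⟩ := h'
  cases b with
  | left w hs hl =>
    exact absurd hb (Set.not_nontrivial_iff.2 (outgoing_left_subsingleton hs hl))
  | right w hs hl => rw [← he1, ← he1', incoming_right_subsingleton hs hl he2 he2']

lemma adj_unique_of_isLeftSpecial {b c c' : (specialRauzyGraph Ω n).V}
    (hb : (specialRauzyGraph Ω n).IsLeftSpecial b) (h : (specialRauzyGraph Ω n).Adj b c)
    (h' : (specialRauzyGraph Ω n).Adj b c') : c = c' := by
  obtain ⟨e, he1, he2⟩ := h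
  obtain ⟨e', he1', he2'⟩ := h'
  cases b with
  | right w hs hl =>
    exact absurd hb (Set.not_nontrivial_iff.2 (incoming_right_subsingleton hs hl))
  | left w hs hl => rw [← he2, ← he2', outgoing_left_subsingleton hs hl he1 he1']

/-- The word of length `n` at position `i` of `x` is special. -/
def SpecialAt (Ω : Set (ℕ → A)) (n : ℕ) (x : ℕ → A) (i : ℕ) : Prop :=
  IsLeftSpecialWord Ω (factor x i n) ∨ IsRightSpecialWord Ω (factor x i n)

lemma rauzyEdge_factor {x : ℕ → A} (hx : x ∈ Ω) (i : ℕ) :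
    RauzyEdge Ω n (factor x i n) (factor x (i + 1) n) :=
  ⟨_, factor_mem_languageOf hx i (n + 1), dropLast_factor x i n, tail_factor x i n⟩

lemma factor_cons_range_map (x : ℕ → A) (i d : ℕ) :
    factor x i n :: ((List.range d).map (fun k => factor x (i + 1 + k) n) ++
      [factor x (i + d + 1) n]) = (List.range (d + 2)).map fun k => factor x (i + k) n := by
  rw [List.range_succ, List.map_append, List.range_succ_eq_map]
  simp only [List.map_cons, List.map_map, add_zero, List.map_nil, List.cons_append]
  congr 2
  apply List.map_congr_left
  intro k _
  simp only [Function.comp_apply]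
  congr 1; omega

/-- The path that the point `x` follows between two consecutive special positions. -/
def orbitPath {x : ℕ → A} (hx : x ∈ Ω) {i d : ℕ} (hs : SpecialAt Ω n x i)
    (hf : SpecialAt Ω n x (i + d + 1))
    (hno : ∀ k, i < k → k < i + d + 1 → ¬ SpecialAt Ω n x k) : SpecialPath Ω n where
  start := factor x i n
  inner := (List.range d).map fun k => factor x (i + 1 + k) n
  finish := factor x (i + d + 1) n
  start_length := by simp
  finish_length := by simp
  start_special := hs
  finish_special := hf
  inner_not_special := by
    intro w hw
    obtain ⟨k, hk, rfl⟩ := List.mem_map.1 hw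
    rw [List.mem_range] at hk
    exact not_or.1 (hno (i + 1 + k) (by omega) (by omega))
  chain := by
    rw [factor_cons_range_map, List.isChain_iff_getElem]
    intro k hk
    simp only [List.getElem_map, List.getElem_range]
    exact rauzyEdge_factor hx (i + k)

lemma orbitPath_eq {x : ℕ → A} {hx : x ∈ Ω} {i d i' d' : ℕ} {hs : SpecialAt Ω n x i}
    {hf : SpecialAt Ω n x (i + d + 1)} {hno} {hs' : SpecialAt Ω n x i'}
    {hf' : SpecialAt Ω n x (i' + d' + 1)} {hno'}
    (h : orbitPath hx hs hf hno = orbitPath hx hs' hf' hno') :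
    d = d' ∧ ∀ k < d + 2, factor x (i + k) n = factor x (i' + k) n := by
  have h1 := congrArg (fun p : SpecialPath Ω n => p.start :: (p.inner ++ [p.finish])) h
  simp only [orbitPath, factor_cons_range_map] at h1
  obtain rfl : d = d' := by simpa using congrArg List.length h1
  refine ⟨rfl, fun k hk => ?_⟩
  rw [List.map_inj_left] at h1
  exact h1 k (by simpa using hk)

/-- The letter missing from the first word is the last letter of the second one, which exists
because `0 < n`. -/
lemma factor_succ_eq {x y : ℕ → A} {i j : ℕ} (hn : 0 < n) (h : factor x i n = factor y j n)
    (h' : factor x (i + 1) n = factor y (j + 1) n) : factor x i (n + 1) = factor y j (n + 1) := by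
  rw [factor_eq_iff] at *
  intro k hk
  rcases Nat.lt_or_ge k n with hkn | hkn
  · exact h k hkn
  · have := h' (n - 1) (by omega)
    rwa [show i + 1 + (n - 1) = i + k by omega, show j + 1 + (n - 1) = j + k by omega] at this

lemma exists_last_before {P : ℕ → Prop} {i j : ℕ} (hi : P i) (hij : i < j) :
    ∃ k, i ≤ k ∧ k < j ∧ P k ∧ ∀ m, k < m → m < j → ¬ P m := by
  induction j, hij using Nat.le_induction with
  | base => exact ⟨i, le_rfl, by omega, hi, fun m h1 h2 => by omega⟩
  | succ j hj ih =>
    by_cases hPj : P j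
    · exact ⟨j, by omega, by omega, hPj, fun m h1 h2 => by omega⟩
    · obtain ⟨k, h1, h2, h3, h4⟩ := ih
      refine ⟨k, h1, by omega, h3, fun m hm hm' => ?_⟩
      rcases Nat.lt_or_ge m j with h | h
      · exact h4 m hm h
      · obtain rfl : m = j := by omega
        exact hPj

lemma exists_first_after {P : ℕ → Prop} {i j : ℕ} (hj : P j) (hij : i < j) :
    ∃ k, i < k ∧ k ≤ j ∧ P k ∧ ∀ m, i < m → m < k → ¬ P m := by
  classical
  have hex : ∃ k, i < k ∧ P k := ⟨j, hij, hj⟩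
  refine ⟨Nat.find hex, (Nat.find_spec hex).1, Nat.find_min' hex ⟨hij, hj⟩,
    (Nat.find_spec hex).2, fun m hm hm' hP => Nat.find_min hex hm' ⟨hm, hP⟩⟩

section Minimal

variable [Finite A] [TopologicalSpace A] [DiscreteTopology A]

lemma exists_special_before (hmin : IsMinimalShift Ω) (haper : IsAperiodic Ω) {x : ℕ → A}
    (hx : x ∈ Ω) {B : ℕ} (hB : complexity Ω n < B) {j : ℕ} (hj : B ≤ j + 1) :
    ∃ i d, i + d = j ∧ j + 1 ≤ i + B ∧ SpecialAt Ω n x i ∧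
      ∀ k, i < k → k < i + d + 1 → ¬ SpecialAt Ω n x k := by
  obtain ⟨i₀, h1, h2, h3⟩ := hmin.exists_leftSpecial_in_window haper hx hB (j + 1 - B)
  obtain ⟨i, h4, h5, h6, h7⟩ := exists_last_before (P := SpecialAt Ω n x) (j := j + 1)
    (Or.inl h3) (by omega)
  refine ⟨i, j - i, by omega, by omega, h6, fun k hk hk' => h7 k hk (by omega)⟩

lemma exists_special_after (hmin : IsMinimalShift Ω) (haper : IsAperiodic Ω) {x : ℕ → A}
    (hx : x ∈ Ω) {B : ℕ} (hB : complexity Ω n < B) (i : ℕ) :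
    ∃ d, d + 1 ≤ B ∧ SpecialAt Ω n x (i + d + 1) ∧
      ∀ k, i < k → k < i + d + 1 → ¬ SpecialAt Ω n x k := by
  obtain ⟨i₀, h1, h2, h3⟩ := hmin.exists_leftSpecial_in_window haper hx hB (i + 1)
  obtain ⟨k, h4, h5, h6, h7⟩ := exists_first_after (P := SpecialAt Ω n x) (i := i)
    (Or.inl h3) (by omega)
  obtain ⟨d, rfl⟩ : ∃ d, k = i + d + 1 := ⟨k - (i + 1), by omega⟩
  exact ⟨d, by omega, h6, h7⟩

/-- Two left extensions of `w` occur in a point of `Ω`. Equal incoming paths would have the same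
last two words, hence the same word of length `n + 1`. -/
lemma isLeftSpecial_left (hmin : IsMinimalShift Ω) (haper : IsAperiodic Ω) (hn : 0 < n)
    {w : List A} (hs : IsLeftSpecialWord Ω w) (hl : w.length = n) :
    (specialRauzyGraph Ω n).IsLeftSpecial (SpecVertex.left w hs hl) := by
  obtain ⟨x, hx⟩ := hmin.nonempty
  set B := complexity Ω n + 1 with hB
  obtain ⟨a, ⟨ha, haw⟩, b, ⟨hb, hbw⟩, hab⟩ := hs.2
  rw [hl] at ha hb
  -- Occurrences after `B` leave room for an earlier special position.
  obtain ⟨j, hj, rfl⟩ := hmin.exists_factor_eq hx ha B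
  obtain ⟨j', hj', rfl⟩ := hmin.exists_factor_eq hx hb B
  rw [tail_factor] at haw hbw
  obtain ⟨i, d, rfl, -, h3, h4⟩ := exists_special_before hmin haper hx (Nat.lt_succ_self _)
    (show B ≤ j + 1 by omega)
  obtain ⟨i', d', rfl, -, h3', h4'⟩ := exists_special_before hmin haper hx (Nat.lt_succ_self _)
    (show B ≤ j' + 1 by omega)
  have h5 : SpecialAt Ω n x (i + d + 1) := Or.inl (haw ▸ hs)
  have h5' : SpecialAt Ω n x (i' + d' + 1) := Or.inl (hbw ▸ hs)
  refine ⟨Sum.inl (orbitPath hx h3 h5 h4), SpecialPath.target_eq_left haw,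
    Sum.inl (orbitPath hx h3' h5' h4'), SpecialPath.target_eq_left hbw, fun heq => hab ?_⟩
  obtain ⟨rfl, h6⟩ := orbitPath_eq (Sum.inl_injective heq)
  exact factor_succ_eq hn (h6 d (by omega)) (h6 (d + 1) (by omega))

lemma isRightSpecial_right (hmin : IsMinimalShift Ω) (haper : IsAperiodic Ω) (hn : 0 < n)
    {w : List A} (hs : IsRightSpecialWord Ω w) (hl : w.length = n) :
    (specialRauzyGraph Ω n).IsRightSpecial (SpecVertex.right w hs hl) := by
  obtain ⟨x, hx⟩ := hmin.nonempty
  obtain ⟨a, ⟨ha, haw⟩, b, ⟨hb, hbw⟩, hab⟩ := hs.2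
  rw [hl] at ha hb
  obtain ⟨i, -, rfl⟩ := hmin.exists_factor_eq hx ha 0
  obtain ⟨i', -, rfl⟩ := hmin.exists_factor_eq hx hb 0
  rw [dropLast_factor] at haw hbw
  obtain ⟨d, -, h3, h4⟩ := exists_special_after hmin haper hx (Nat.lt_succ_self _) i
  obtain ⟨d', -, h3', h4'⟩ := exists_special_after hmin haper hx (Nat.lt_succ_self _) i'
  have h5 : SpecialAt Ω n x i := Or.inr (haw ▸ hs)
  have h5' : SpecialAt Ω n x i' := Or.inr (hbw ▸ hs)
  refine ⟨Sum.inl (orbitPath hx h5 h3 h4), SpecialPath.source_eq_right haw,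
    Sum.inl (orbitPath hx h5' h3' h4'), SpecialPath.source_eq_right hbw, fun heq => hab ?_⟩
  obtain ⟨rfl, h6⟩ := orbitPath_eq (Sum.inl_injective heq)
  exact factor_succ_eq hn (h6 0 (by omega)) (h6 1 (by omega))

/-- Shortly before an occurrence of a vertex there is an occurrence of a predecessor. -/
lemma exists_adj_before (hmin : IsMinimalShift Ω) (haper : IsAperiodic Ω) {x : ℕ → A}
    (hx : x ∈ Ω) {B : ℕ} (hB : complexity Ω n < B) (b : SpecVertex Ω n) {j : ℕ} (hj : B ≤ j)
    (h : factor x j n = b.word) : ∃ c : SpecVertex Ω n, (specialRauzyGraph Ω n).Adj c b ∧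
      ∃ i, j ≤ i + B ∧ i ≤ j ∧ factor x i n = c.word := by
  obtain ⟨j, rfl⟩ : ∃ j', j = j' + 1 := ⟨j - 1, by omega⟩
  obtain ⟨i, d, rfl, h2, h3, h4⟩ := exists_special_before hmin haper hx hB hj
  have key : ∀ h5 : SpecialAt Ω n x (i + d + 1), (orbitPath hx h3 h5 h4).target = b →
      ∃ c : SpecVertex Ω n, (specialRauzyGraph Ω n).Adj c b ∧
        ∃ k, i + d + 1 ≤ k + B ∧ k ≤ i + d + 1 ∧ factor x k n = c.word := fun h5 htgt =>
    ⟨(orbitPath hx h3 h5 h4).source, ⟨Sum.inl (orbitPath hx h3 h5 h4), rfl, htgt⟩, i, h2, by omega,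
      (SpecialPath.word_source (orbitPath hx h3 h5 h4)).symm⟩
  cases b with
  | left w hs hl => exact key (Or.inl (h ▸ hs)) (SpecialPath.target_eq_left h)
  | right w hs hl =>
    -- For bispecial `w` the predecessor of the `right` copy is the `left` copy, at the same
    -- position.
    by_cases hls : IsLeftSpecialWord Ω w
    · exact ⟨.left w hls hl, ⟨Sum.inr ⟨w, hl, hls, hs⟩, rfl, rfl⟩, i + d + 1, by omega, le_rfl, h⟩
    · exact key (Or.inr (h ▸ hs)) (SpecialPath.target_eq_right h hls)

/-- Shortly after an occurrence of a vertex there is an occurrence of a successor. -/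
lemma exists_adj_after (hmin : IsMinimalShift Ω) (haper : IsAperiodic Ω) {x : ℕ → A}
    (hx : x ∈ Ω) {B : ℕ} (hB : complexity Ω n < B) (b : SpecVertex Ω n) {i : ℕ}
    (h : factor x i n = b.word) : ∃ c : SpecVertex Ω n, (specialRauzyGraph Ω n).Adj b c ∧
      ∃ j, i ≤ j ∧ j ≤ i + B ∧ factor x j n = c.word := by
  obtain ⟨d, h2, h3, h4⟩ := exists_special_after hmin haper hx hB i
  have key : ∀ h5 : SpecialAt Ω n x i, (orbitPath hx h5 h3 h4).source = b →
      ∃ c : SpecVertex Ω n, (specialRauzyGraph Ω n).Adj b c ∧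
        ∃ j, i ≤ j ∧ j ≤ i + B ∧ factor x j n = c.word := fun h5 hsrc =>
    ⟨(orbitPath hx h5 h3 h4).target, ⟨Sum.inl (orbitPath hx h5 h3 h4), hsrc, rfl⟩, i + d + 1, by omega, by omega,
      (SpecialPath.word_target (orbitPath hx h5 h3 h4)).symm⟩
  cases b with
  | right w hs hl => exact key (Or.inr (h ▸ hs)) (SpecialPath.source_eq_right h)
  | left w hs hl =>
    by_cases hrs : IsRightSpecialWord Ω w
    · exact ⟨.right w hrs hl, ⟨Sum.inr ⟨w, hl, hs, hrs⟩, rfl, rfl⟩, i, le_rfl, by omega, h⟩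
    · exact key (Or.inl (h ▸ hs)) (SpecialPath.source_eq_left h hrs)

end Minimal

lemma SpecVertex.word_length (b : SpecVertex Ω n) : b.word.length = n := by
  cases b <;> assumption

lemma finite_specVertex [Finite A] : Finite (SpecVertex Ω n) := by
  classical
  have := (List.finite_length_eq A n).to_subtype
  let f : SpecVertex Ω n → {l : List A | l.length = n} × Bool := fun b =>
    (⟨b.word, b.word_length⟩, match b with | .left .. => true | .right .. => false)
  refine Finite.of_injective f ?_
  rintro (⟨w, h, h'⟩ | ⟨w, h, h'⟩) (⟨w', k, k'⟩ | ⟨w', k, k'⟩) heq <;>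
    simp_all [f, SpecVertex.word]

/-- Adjacency is transported by isomorphisms. -/
lemma MultiDigraph.Iso.adj_iff {G : MultiDigraph.{v}} {H : MultiDigraph.{u}} (φ : G.Iso H)
    {a b : G.V} : H.Adj (φ.vert a) (φ.vert b) ↔ G.Adj a b := by
  constructor
  · rintro ⟨e, h1, h2⟩
    refine ⟨φ.edge.symm e, φ.vert.injective ?_, φ.vert.injective ?_⟩
    · rw [← φ.src_edge, Equiv.apply_symm_apply, h1]
    · rw [← φ.tgt_edge, Equiv.apply_symm_apply, h2]
  · rintro ⟨e, h1, h2⟩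
    exact ⟨φ.edge e, by rw [φ.src_edge, h1], by rw [φ.tgt_edge, h2]⟩

lemma MultiDigraph.Iso.isLeftSpecial_iff {G : MultiDigraph.{v}} {H : MultiDigraph.{u}}
    (φ : G.Iso H) {a : G.V} : H.IsLeftSpecial (φ.vert a) ↔ G.IsLeftSpecial a := by
  have : {e | H.tgt e = φ.vert a} = φ.edge '' {e | G.tgt e = a} := by
    ext e
    obtain ⟨e, rfl⟩ := φ.edge.surjective e
    simp [φ.tgt_edge]
  rw [IsLeftSpecial, this, Set.image_nontrivial φ.edge.injective]
  rfl

lemma MultiDigraph.Iso.isRightSpecial_iff {G : MultiDigraph.{v}} {H : MultiDigraph.{u}}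
    (φ : G.Iso H) {a : G.V} : H.IsRightSpecial (φ.vert a) ↔ G.IsRightSpecial a := by
  have : {e | H.src e = φ.vert a} = φ.edge '' {e | G.src e = a} := by
    ext e
    obtain ⟨e, rfl⟩ := φ.edge.surjective e
    simp [φ.src_edge]
  rw [IsRightSpecial, this, Set.image_nontrivial φ.edge.injective]
  rfl

end GraphStructure

/-! ### Upper densities and the pigeonhole over finitely many words. -/

section DensityLemmas

variable {A : Type u}

lemma frequently_of_frequently_exists {ι α : Type*} [Finite ι] {l : Filter α}
    {p : ι → α → Prop} (h : ∃ᶠ y in l, ∃ a, p a y) : ∃ a, ∃ᶠ y in l, p a y := by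
  by_contra! hno
  refine h ?_
  filter_upwards [eventually_all.2 hno] with y hy
  exact fun ⟨a, ha⟩ => hy a ha

lemma tendsto_coe_atTop {J : Set ℕ} (hJ : J.Infinite) :
    Tendsto (fun n : J => (n : ℕ)) atTop atTop := by
  refine tendsto_atTop.2 fun b => ?_
  obtain ⟨m, hm, hbm⟩ := hJ.exists_gt b
  filter_upwards [eventually_ge_atTop (⟨m, hm⟩ : J)] with n hn
  have : m ≤ (n : ℕ) := hn
  omega

lemma blockIndicator_le_one (L : ℕ) (w : List A) (x : ℕ → A) (j : ℕ) :
    (blockIndicator L w x j : ℝ) ≤ 1 := by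
  unfold blockIndicator
  split_ifs <;> simp

lemma blockAverage_nonneg (L N : ℕ) (w : List A) (x : ℕ → A) : 0 ≤ blockAverage L N w x := by
  unfold blockAverage
  positivity

lemma blockAverage_le_one (L N : ℕ) (w : List A) (x : ℕ → A) : blockAverage L N w x ≤ 1 := by
  unfold blockAverage
  refine div_le_one_of_le₀ ?_ (by positivity)
  calc _ ≤ ∑ _j ∈ Finset.range N, (1 : ℝ) :=
        Finset.sum_le_sum fun j _ => blockIndicator_le_one L w x j
    _ = N := by simp

lemma isBoundedUnder_blockAverage (L : ℕ) (w : List A) (x : ℕ → A) :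
    IsBoundedUnder (· ≤ ·) atTop fun N : ℕ => blockAverage L N w x :=
  isBoundedUnder_of ⟨1, fun N => blockAverage_le_one L N w x⟩

lemma isCoboundedUnder_blockAverage (L : ℕ) (w : List A) (x : ℕ → A) :
    IsCoboundedUnder (· ≤ ·) atTop fun N : ℕ => blockAverage L N w x :=
  isCoboundedUnder_le_of_le atTop fun N => blockAverage_nonneg L N w x

lemma wordDensity_nonneg (L : ℕ) (w : List A) (x : ℕ → A) : 0 ≤ wordDensity L w x :=
  le_limsup_of_frequently_le (Frequently.of_forall fun N => blockAverage_nonneg L N w x)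
    (isBoundedUnder_blockAverage L w x)

lemma wordDensity_le_one (L : ℕ) (w : List A) (x : ℕ → A) : wordDensity L w x ≤ 1 :=
  limsup_le_of_le (isCoboundedUnder_blockAverage L w x)
    (Eventually.of_forall fun N => blockAverage_le_one L N w x)

lemma frequently_lt_blockAverage {L : ℕ} {w : List A} {x : ℕ → A} {c : ℝ}
    (h : c < wordDensity L w x) : ∃ᶠ N : ℕ in atTop, c < blockAverage L N w x :=
  frequently_lt_of_lt_limsup (isCoboundedUnder_blockAverage L w x) h

lemma frequently_lt_wordDensity {L : ℕ} {J : Set ℕ} (hJ : J.Infinite) {w : J → List A}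
    {x : ℕ → A} {c : ℝ} (h : c < disjointDensity L w x) :
    ∃ᶠ n : J in atTop, c < wordDensity L (w n) x := by
  have := hJ.nonempty.to_subtype
  exact frequently_lt_of_lt_limsup
    (isCoboundedUnder_le_of_le atTop fun n => wordDensity_nonneg L (w n) x) h

lemma le_disjointDensity {L : ℕ} {J : Set ℕ} {w : J → List A} {x : ℕ → A} {c : ℝ}
    (h : ∃ᶠ n : J in atTop, c ≤ wordDensity L (w n) x) : c ≤ disjointDensity L w x :=
  le_limsup_of_frequently_le h (isBoundedUnder_of ⟨1, fun n => wordDensity_le_one L (w n) x⟩)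

/-- Each block of a word serves at most three neighboring values of `f`. The leading `1` pays for `f
0`, and the `1` for each word pays for block `N`, which lies just outside the range. -/
lemma sum_range_le_of_cover {ι : Type*} [Fintype ι] {L : ℕ} {w : ι → List A} {x : ℕ → A}
    {f : ℕ → ℝ} (hf : ∀ j, f j ≤ 1)
    (hcov : ∀ j, f (j + 1) ≤ 0 ∨
      ∃ a, ∃ k, j ≤ k ∧ k ≤ j + 2 ∧ blockIndicator L (w a) x k = 1) (N : ℕ) :
    ∑ j ∈ Finset.range N, f j ≤
      1 + ∑ a, (3 * ∑ j ∈ Finset.range N, (blockIndicator L (w a) x j : ℝ) + 1) := by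
  set I : ι → ℕ → ℝ := fun a j => blockIndicator L (w a) x j with hI
  have hI0 : ∀ a j, 0 ≤ I a j := fun a j => Nat.cast_nonneg _
  have hI1 : ∀ a j, I a j ≤ 1 := fun a j => blockIndicator_le_one L (w a) x j
  have hstep : ∀ j, f (j + 1) ≤ ∑ a, (I a j + I a (j + 1) + I a (j + 2)) := by
    intro j
    rcases hcov j with h | ⟨a, k, h1, h2, h3⟩
    · exact h.trans (Finset.sum_nonneg fun a _ => by
        linarith [hI0 a j, hI0 a (j + 1), hI0 a (j + 2)])
    · have h4 : I a k = 1 := by simp [hI, h3]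
      have h5 : 1 ≤ I a j + I a (j + 1) + I a (j + 2) := by
        have hk : k = j ∨ k = j + 1 ∨ k = j + 2 := by omega
        rcases hk with hk | hk | hk <;> rw [hk] at h4 <;>
          linarith [hI0 a j, hI0 a (j + 1), hI0 a (j + 2)]
      refine ((hf _).trans h5).trans (Finset.single_le_sum
        (f := fun a => I a j + I a (j + 1) + I a (j + 2)) (fun a _ => ?_) (Finset.mem_univ a))
      linarith [hI0 a j, hI0 a (j + 1), hI0 a (j + 2)]
  have hmain : ∀ M, ∑ j ∈ Finset.range (M + 1), f j ≤ 1 + ∑ a, (∑ j ∈ Finset.range M, I a j +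
      ∑ j ∈ Finset.range (M + 1), I a j + ∑ j ∈ Finset.range (M + 2), I a j) := by
    intro M
    induction M with
    | zero =>
      have : 0 ≤ ∑ a, (∑ j ∈ Finset.range 0, I a j +
          ∑ j ∈ Finset.range (0 + 1), I a j + ∑ j ∈ Finset.range (0 + 2), I a j) := by positivity
      simp only [zero_add, Finset.sum_range_one] at this ⊢
      linarith [hf 0]
    | succ M ih =>
      rw [Finset.sum_range_succ]
      have h1 := hstep M
      have h2 : ∑ a, (∑ j ∈ Finset.range (M + 1), I a j + ∑ j ∈ Finset.range (M + 1 + 1), I a j +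
          ∑ j ∈ Finset.range (M + 1 + 2), I a j) = ∑ a, (∑ j ∈ Finset.range M, I a j +
          ∑ j ∈ Finset.range (M + 1), I a j + ∑ j ∈ Finset.range (M + 2), I a j) +
          ∑ a, (I a M + I a (M + 1) + I a (M + 2)) := by
        rw [← Finset.sum_add_distrib]
        refine Finset.sum_congr rfl fun a _ => ?_
        rw [Finset.sum_range_succ _ (M + 2), Finset.sum_range_succ _ (M + 1),
          Finset.sum_range_succ _ M]
        ring
      linarith
  cases N with
  | zero =>
    have : (0 : ℝ) ≤ ∑ a, (3 * ∑ j ∈ Finset.range 0, I a j + 1) := by positivity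
    simp only [Finset.range_zero, Finset.sum_empty] at this ⊢
    linarith
  | succ M =>
    refine (hmain M).trans (add_le_add le_rfl (Finset.sum_le_sum fun a _ => ?_))
    rw [Finset.sum_range_succ _ (M + 1), Finset.sum_range_succ _ M]
    linarith [hI0 a M, hI1 a (M + 1)]

/-- If a block function of average more than `δ` is covered by the neighbouring blocks of finitely
many words, then one of the words has large density. -/
lemma exists_le_wordDensity_of_cover {ι : Type*} [Finite ι] {L : ℕ} {w : ι → List A} {x : ℕ → A}
    {f : ℕ → ℝ} (hf : ∀ j, f j ≤ 1)
    (hcov : ∀ j, f (j + 1) ≤ 0 ∨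
      ∃ a, ∃ k, j ≤ k ∧ k ≤ j + 2 ∧ blockIndicator L (w a) x k = 1) {δ : ℝ} (hδ : 0 < δ)
    (hfreq : ∃ᶠ N : ℕ in atTop, δ < (∑ j ∈ Finset.range N, f j) / N) :
    ∃ a, δ / (6 * (Nat.card ι + 1)) ≤ wordDensity L (w a) x := by
  have := Fintype.ofFinite ι
  have key : ∃ᶠ N : ℕ in atTop, ∃ a, δ / (6 * (Nat.card ι + 1)) ≤ blockAverage L N (w a) x := by
    -- For such `N` the boundary terms stay below half of `δ * N`; if all averages were below δ /
    -- (6(card + 1)), the main terms would stay within the other half.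
    obtain ⟨N₁, hN₁⟩ := exists_nat_gt ((1 + Nat.card ι) / (δ / 2))
    refine (hfreq.and_eventually (eventually_ge_atTop (N₁ + 1))).mono ?_
    rintro N ⟨h1, h2⟩
    have hN : (0 : ℝ) < N := by exact_mod_cast (by omega : 0 < N)
    have hNN : (N₁ : ℝ) ≤ N := by exact_mod_cast (by omega : N₁ ≤ N)
    have h3 : (1 + Nat.card ι : ℝ) < N * (δ / 2) := by
      rw [div_lt_iff₀ (by positivity)] at hN₁
      nlinarith
    rw [lt_div_iff₀ hN] at h1
    have h4 := sum_range_le_of_cover hf hcov N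
    by_contra! hno
    have h5 : ∀ a, 3 * ∑ j ∈ Finset.range N, (blockIndicator L (w a) x j : ℝ) + 1 ≤
        δ / (2 * (Nat.card ι + 1)) * N + 1 := by
      intro a
      have := (hno a).le
      unfold blockAverage at this
      rw [div_le_iff₀ hN] at this
      have h6 : δ / (2 * (Nat.card ι + 1)) * N = 3 * (δ / (6 * (Nat.card ι + 1)) * N) := by
        field_simp; norm_num
      linarith
    have h6 := Finset.sum_le_sum (s := Finset.univ) fun a _ => h5 a
    rw [Finset.sum_const, Finset.card_univ, ← Nat.card_eq_fintype_card, nsmul_eq_mul] at h6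
    have h7 : (Nat.card ι : ℝ) * (δ / (2 * (Nat.card ι + 1)) * N) ≤ δ / 2 * N := by
      have : (Nat.card ι : ℝ) * (δ / (2 * (Nat.card ι + 1)) * N) =
          (Nat.card ι / (Nat.card ι + 1)) * (δ / 2 * N) := by field_simp
      rw [this]
      refine mul_le_of_le_one_left (by positivity) (div_le_one_of_le₀ (by linarith) (by positivity))
    linarith
  obtain ⟨a, ha⟩ := frequently_of_frequently_exists key
  exact ⟨a, le_limsup_of_frequently_le ha (isBoundedUnder_blockAverage L (w a) x)⟩

lemma exists_disjointDensity_pos_of_cover {ι : Type*} [Finite ι] {L : ℕ} {J : Set ℕ}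
    {w : ι → J → List A} {x : ℕ → A} {δ : ℝ} (hδ : 0 < δ)
    (h : ∃ᶠ n : J in atTop, ∃ f : ℕ → ℝ, (∀ j, f j ≤ 1) ∧
      (∀ j, f (j + 1) ≤ 0 ∨ ∃ a, ∃ k, j ≤ k ∧ k ≤ j + 2 ∧ blockIndicator L (w a n) x k = 1) ∧
      ∃ᶠ N : ℕ in atTop, δ < (∑ j ∈ Finset.range N, f j) / N) :
    ∃ a, 0 < disjointDensity L (w a) x := by
  have key : ∃ᶠ n : J in atTop, ∃ a, δ / (6 * (Nat.card ι + 1)) ≤ wordDensity L (w a n) x := by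
    refine h.mono ?_
    rintro n ⟨f, hf, hcov, hfreq⟩
    exact exists_le_wordDensity_of_cover hf hcov hδ hfreq
  obtain ⟨a, ha⟩ := frequently_of_frequently_exists key
  exact ⟨a, lt_of_lt_of_le (by positivity) (le_disjointDensity ha)⟩

lemma blockIndicator_eq_one {L : ℕ} {w : List A} {x : ℕ → A} {i : ℕ} (hL : 0 < L * w.length)
    (h : OccursAt w x i) : blockIndicator L w x (i / (L * w.length)) = 1 := by
  unfold blockIndicator
  rw [if_pos]
  exact ⟨i, Nat.div_mul_le_self _ _, Nat.lt_mul_of_div_lt (Nat.lt_succ_self _) hL, h⟩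

/-- An occurrence close to the block `j + 1` begins in one of the blocks `j`, `j + 1`, `j + 2`. -/
lemma exists_blockIndicator_eq_one {L : ℕ} {w : List A} {x : ℕ → A} {i i' j : ℕ}
    (hL : 0 < L * w.length) (hi : (j + 1) * (L * w.length) ≤ i)
    (hi' : i < (j + 1 + 1) * (L * w.length)) (h1 : i ≤ i' + L * w.length)
    (h2 : i' ≤ i + L * w.length) (h : OccursAt w x i') :
    ∃ k, j ≤ k ∧ k ≤ j + 2 ∧ blockIndicator L w x k = 1 := by
  refine ⟨i' / (L * w.length), ?_, ?_, blockIndicator_eq_one hL h⟩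
  · rw [Nat.le_div_iff_mul_le hL]
    rw [add_mul] at hi
    omega
  · rw [← Nat.lt_succ_iff, Nat.div_lt_iff_lt_mul hL]
    rw [add_mul] at hi'
    rw [Nat.succ_eq_add_one, show j + 2 + 1 = j + 1 + 1 + 1 by rfl, add_mul, add_mul]
    omega

end DensityLemmas

/-! ### Comparing word frequencies with a generic point. -/

section Frequencies

variable {A : Type u}

lemma prefix_drop_factor_iff {s : List A} {x : ℕ → A} {i j n : ℕ} (h : j + s.length ≤ n) :
    s <+: (factor x i n).drop j ↔ OccursAt s x (i + j) := by
  have h1 : ((factor x i n).drop j).take s.length = factor x (i + j) s.length := by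
    apply List.ext_getElem
    · simp; omega
    · intro k _ _
      simp only [List.getElem_take, List.getElem_drop, getElem_factor]
      congr 1; omega
  rw [List.prefix_iff_eq_take, h1, OccursAt, eq_comm]

lemma occurrences_factor (s : List A) (x : ℕ → A) (i n : ℕ) :
    occurrences s (factor x i n) = {j | j + s.length ≤ n ∧ OccursAt s x (i + j)}.ncard := by
  unfold occurrences
  congr 1
  ext j
  simp only [length_factor, Set.mem_ofPred_eq]
  exact and_congr_right fun h => prefix_drop_factor_iff h

lemma finite_occurrence_positions (s : List A) (x : ℕ → A) (i n : ℕ) :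
    {j | j + s.length ≤ n ∧ OccursAt s x (i + j)}.Finite :=
  (Set.finite_le_nat n).subset fun _ h => le_trans (Nat.le_add_right _ _) h.1

lemma occurrences_factor_mono (s : List A) (x : ℕ → A) (i : ℕ) {m n : ℕ} (h : m ≤ n) :
    occurrences s (factor x i m) ≤ occurrences s (factor x i n) := by
  rw [occurrences_factor, occurrences_factor]
  exact Set.ncard_le_ncard (fun j hj => ⟨hj.1.trans h, hj.2⟩) (finite_occurrence_positions s x i n)

/-- Occurrences in disjoint stretches add up. For empty `s` the position at the seam could be
counted twice. -/
lemma occurrences_add_le {s w : List A} {x : ℕ → A} {i a b : ℕ} (hs : s ≠ []) (hw : OccursAt w x i)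
    (ha : a ≤ i) (hb : i + w.length ≤ b) :
    occurrences s (factor x 0 a) + occurrences s w ≤ occurrences s (factor x 0 b) := by
  have hpos := List.length_pos_iff.2 hs
  have h1 : occurrences s w = occurrences s (factor x i w.length) := congrArg _ hw.symm
  rw [h1, occurrences_factor, occurrences_factor, occurrences_factor,
    ← Set.ncard_image_of_injective {j | j + s.length ≤ w.length ∧ OccursAt s x (i + j)}
      (add_right_injective i), ← Set.ncard_union_eq _ (finite_occurrence_positions s x 0 a)
      ((finite_occurrence_positions s x i w.length).image _)]
  · refine Set.ncard_le_ncard ?_ (finite_occurrence_positions s x 0 b)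
    rintro j (⟨h2, h3⟩ | ⟨j, ⟨h2, h3⟩, rfl⟩)
    · exact ⟨by omega, h3⟩
    · exact ⟨by beta_reduce; omega, by simpa using h3⟩
  · rw [Set.disjoint_left]
    rintro _ ⟨h2, h3⟩ ⟨j, ⟨h4, h5⟩, rfl⟩
    beta_reduce at h2
    omega

/-- An occurrence that begins in block `N` may run into block `N + 1` but, as `0 < L`, no further.
Two consecutive prefixes on the right absorb this overlap and produce the factor 2 below. -/
lemma sum_blockIndicator_mul_occurrences_le {L : ℕ} (hL : 0 < L) {s : List A} (hs : s ≠ [])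
    (w : List A) (x : ℕ → A) (N : ℕ) :
    (∑ j ∈ Finset.range N, blockIndicator L w x j) * occurrences s w ≤
      occurrences s (factor x 0 (N * (L * w.length))) +
        occurrences s (factor x 0 ((N + 1) * (L * w.length))) := by
  induction N with
  | zero => simp
  | succ N ih =>
    rw [Finset.sum_range_succ, add_mul]
    have h : occurrences s (factor x 0 (N * (L * w.length))) +
        blockIndicator L w x N * occurrences s w ≤
        occurrences s (factor x 0 ((N + 1 + 1) * (L * w.length))) := by
      unfold blockIndicator
      split_ifs with hocc
      · obtain ⟨i, h1, h2, h3⟩ := hocc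
        rw [one_mul]
        refine occurrences_add_le hs h3 h1 ?_
        have : w.length ≤ L * w.length := Nat.le_mul_of_pos_left _ hL
        rw [add_mul (N + 1)]
        omega
      · rw [zero_mul, add_zero]
        exact occurrences_factor_mono s x 0 (Nat.mul_le_mul_right _ (by omega))
    omega

lemma mem_wordCylinder_factor (x : ℕ → A) (m : ℕ) : x ∈ wordCylinder (factor x 0 m) :=
  occursAt_factor x 0 m

lemma mem_wordCylinder_iff {s : List A} {y : ℕ → A} {m : ℕ} (h : s.length = m) :
    y ∈ wordCylinder s ↔ factor y 0 m = s := by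
  subst h; rfl

lemma exists_wordCylinder_subset [TopologicalSpace A] {U : Set (ℕ → A)} (hU : IsOpen U) {x : ℕ → A} (hx : x ∈ U) :
    ∃ m, wordCylinder (factor x 0 m) ⊆ U := by
  obtain ⟨I, u, hu, hsub⟩ := isOpen_pi_iff.1 hU x hx
  refine ⟨I.sup id + 1, fun y hy => hsub fun i hi => ?_⟩
  rw [mem_wordCylinder_iff (length_factor x 0 _), factor_eq_iff] at hy
  have := hy i (Nat.lt_succ_of_le (Finset.le_sup (f := id) hi))
  simp only [zero_add] at this
  rw [this]
  exact (hu i hi).2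

variable [MeasurableSpace A]

lemma mul_occurrences_le_of_lt_wordDensity {L : ℕ} (hL : 0 < L) {s w : List A} (hs : s ≠ [])
    (hw : w ≠ []) {x : ℕ → A} {ν : Measure (ℕ → A)} (hx : IsGeneric x ν) {c : ℝ}
    (hc : c < wordDensity L w x) :
    c * occurrences s w ≤ 2 * (L * w.length) * ν.real (wordCylinder s) := by
  have hB : 0 < L * w.length := Nat.mul_pos hL (List.length_pos_iff.2 hw)
  set B := L * w.length with hBdef
  -- The factor N/(N+1) compares an average over `N` blocks with a prefix of `N + 1` blocks.
  have hlim1 : Tendsto (fun N : ℕ => c * occurrences s w * ((N : ℝ) / (N + 1))) atTop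
      (𝓝 (c * occurrences s w * 1)) :=
    (tendsto_natCast_div_add_atTop (1 : ℝ)).const_mul _
  have hM : Tendsto (fun N : ℕ => (N + 1) * B) atTop atTop :=
    tendsto_atTop_mono (fun N => (Nat.le_succ N).trans (Nat.le_mul_of_pos_right _ hB)) tendsto_id
  have hlim2 := ((hx s).comp hM).const_mul (2 * (B : ℝ))
  have h := le_of_tendsto_of_tendsto_of_frequently hlim1 hlim2 ?_
  · rw [mul_one] at h
    simpa [hBdef] using h
  refine ((frequently_lt_blockAverage hc).and_eventually (eventually_gt_atTop 0)).mono ?_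
  rintro N ⟨h1, h2⟩
  have hN : (0 : ℝ) < N := by exact_mod_cast h2
  have hBr : (0 : ℝ) < B := by exact_mod_cast hB
  unfold blockAverage at h1
  rw [lt_div_iff₀ hN] at h1
  have h3 := sum_blockIndicator_mul_occurrences_le hL hs w x N
  rw [← hBdef] at h3
  have h4 : occurrences s (factor x 0 (N * B)) ≤ occurrences s (factor x 0 ((N + 1) * B)) :=
    occurrences_factor_mono s x 0 (Nat.mul_le_mul_right _ (by omega))
  have h5 : (∑ j ∈ Finset.range N, (blockIndicator L w x j : ℝ)) * occurrences s w ≤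
      2 * occurrences s (factor x 0 ((N + 1) * B)) := by
    exact_mod_cast (by omega : (∑ j ∈ Finset.range N, blockIndicator L w x j) * occurrences s w ≤
      2 * occurrences s (factor x 0 ((N + 1) * B)))
  have h6 : c * N * occurrences s w ≤ 2 * occurrences s (factor x 0 ((N + 1) * B)) :=
    (mul_le_mul_of_nonneg_right h1.le (Nat.cast_nonneg _)).trans h5
  simp only [Function.comp_apply]
  push_cast
  have h7 : 2 * (B : ℝ) * ((occurrences s (factor x 0 ((N + 1) * B)) : ℝ) / ((N + 1) * B)) =
      2 * occurrences s (factor x 0 ((N + 1) * B)) / (N + 1) := by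
    field_simp
  rw [h7, ← mul_div_assoc]
  exact div_le_div_of_nonneg_right (by linarith) (by positivity)

/-- The measure generated by words of positive density is dominated on cylinders. -/
lemma mul_real_wordCylinder_le {L : ℕ} (hL : 0 < L) {Ω : Set (ℕ → A)} {J : Set ℕ}
    (hJ : J.Infinite) {w : J → List A} (hw : ∀ n, w n ≠ []) {x : ℕ → A} {μ ν : Measure (ℕ → A)}
    (hμ : Generates Ω w μ) (hx : IsGeneric x ν) {c : ℝ} (hc : c < disjointDensity L w x)
    {s : List A} (hs : s ≠ []) :
    c * μ.real (wordCylinder s) ≤ 2 * L * ν.real (wordCylinder s) := by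
  refine le_of_tendsto_of_frequently ((hμ.tendsto s).const_mul c) ?_
  refine (frequently_lt_wordDensity hJ hc).mono fun n hn => ?_
  have h1 := mul_occurrences_le_of_lt_wordDensity hL hs (hw n) hx hn
  have h2 : (0 : ℝ) < (w n).length := by exact_mod_cast List.length_pos_iff.2 (hw n)
  rw [← mul_div_assoc, div_le_iff₀ h2]
  linarith

end Frequencies

/-! ### From cylinder bounds to equality of measures. -/

section Domination

variable {A : Type u} [Finite A] [TopologicalSpace A] [DiscreteTopology A]
  [MeasurableSpace A] [DiscreteMeasurableSpace A]

lemma measurableSet_wordCylinder (s : List A) : MeasurableSet (wordCylinder s) :=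
  (isOpen_wordCylinder s).measurableSet

/-- An open set is the increasing union of the sets `V m`, each a finite disjoint union of cylinders
of length `m + 1`; this length keeps the words nonempty. -/
lemma measure_le_of_wordCylinder_le {μ ν : Measure (ℕ → A)} {C : ENNReal}
    (h : ∀ s : List A, s ≠ [] → μ (wordCylinder s) ≤ C * ν (wordCylinder s))
    {U : Set (ℕ → A)} (hU : IsOpen U) : μ U ≤ C * ν U := by
  have hfin : ∀ m : ℕ, {s : List A | s.length = m + 1 ∧ wordCylinder s ⊆ U}.Finite := fun m =>
    (List.finite_length_eq A (m + 1)).subset fun s hs => hs.1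
  set V : ℕ → Set (ℕ → A) := fun m => ⋃ s ∈ (hfin m).toFinset, wordCylinder s with hV
  have hVmem : ∀ m y, y ∈ V m ↔ wordCylinder (factor y 0 (m + 1)) ⊆ U := by
    intro m y
    simp only [hV, Set.mem_iUnion, Set.Finite.mem_toFinset, exists_prop]
    constructor
    · rintro ⟨s, ⟨hl, hs⟩, hy⟩
      rw [mem_wordCylinder_iff hl] at hy
      rwa [hy]
    · exact fun hy => ⟨_, ⟨length_factor _ _ _, hy⟩, mem_wordCylinder_factor y _⟩
  have hmono : Monotone V := by
    refine monotone_nat_of_le_succ fun m y hy => ?_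
    rw [hVmem] at *
    refine Set.Subset.trans (fun z hz => ?_) hy
    rw [mem_wordCylinder_iff (length_factor _ _ _), factor_eq_iff] at *
    exact fun k hk => hz k (by omega)
  have hunion : U = ⋃ m, V m := by
    ext y
    rw [Set.mem_iUnion]
    constructor
    · intro hy
      obtain ⟨m, hm⟩ := exists_wordCylinder_subset hU hy
      refine ⟨m, (hVmem m y).2 (Set.Subset.trans (fun z hz => ?_) hm)⟩
      rw [mem_wordCylinder_iff (length_factor _ _ _), factor_eq_iff] at *
      exact fun k hk => hz k (by omega)
    · rintro ⟨m, hm⟩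
      exact (hVmem m y).1 hm (mem_wordCylinder_factor y _)
  have hsum : ∀ (ρ : Measure (ℕ → A)) (m : ℕ),
      ρ (V m) = ∑ s ∈ (hfin m).toFinset, ρ (wordCylinder s) := by
    intro ρ m
    refine measure_biUnion_finset ?_ fun s _ => measurableSet_wordCylinder s
    intro s hs t ht hst
    simp only [Set.Finite.coe_toFinset, Set.mem_ofPred_eq] at hs ht
    refine Set.disjoint_left.2 fun y hy hy' => hst ?_
    rw [mem_wordCylinder_iff hs.1] at hy
    rw [mem_wordCylinder_iff ht.1] at hy'
    exact hy.symm.trans hy'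
  nth_rw 1 [hunion]
  rw [hmono.measure_iUnion]
  refine iSup_le fun m => ?_
  calc μ (V m) = ∑ s ∈ (hfin m).toFinset, μ (wordCylinder s) := hsum μ m
    _ ≤ ∑ s ∈ (hfin m).toFinset, C * ν (wordCylinder s) := by
        refine Finset.sum_le_sum fun s hs => h s ?_
        rw [Set.Finite.mem_toFinset] at hs
        exact List.ne_nil_of_length_eq_add_one hs.1
    _ = C * ν (V m) := by rw [hsum ν m, Finset.mul_sum]
    _ ≤ C * ν U := by
        gcongr
        exact fun y hy => (hVmem m y).1 hy (mem_wordCylinder_factor y _)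

/-- By outer regularity a `ν`-null set lies in open sets of arbitrarily small `ν`-measure, to which
the open-set bound applies. -/
lemma absolutelyContinuous_of_wordCylinder_le {μ ν : Measure (ℕ → A)} [IsFiniteMeasure ν]
    {C : ENNReal} (hC : C ≠ ⊤)
    (h : ∀ s : List A, s ≠ [] → μ (wordCylinder s) ≤ C * ν (wordCylinder s)) : μ ≪ ν := by
  intro t ht
  have hlim : Tendsto (fun ε : ENNReal => C * ε) (𝓝[>] 0) (𝓝 (C * 0)) :=
    ((ENNReal.continuous_const_mul hC).tendsto 0).mono_left nhdsWithin_le_nhds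
  rw [mul_zero] at hlim
  refine le_antisymm (ge_of_tendsto hlim ?_) zero_le
  filter_upwards [self_mem_nhdsWithin] with ε hε
  obtain ⟨U, hU, hUo, hlt⟩ := t.exists_isOpen_lt_of_lt (μ := ν) ε (by rw [ht]; exact hε)
  calc μ t ≤ μ U := measure_mono hU
    _ ≤ C * ν U := measure_le_of_wordCylinder_le h hUo
    _ ≤ C * ε := by gcongr

/-- If words that generate `μ` have positive density in a generic point of the ergodic
measure `ν`, then `μ = ν`. -/
lemma eq_of_disjointDensity_pos {L : ℕ} (hL : 0 < L) {Ω : Set (ℕ → A)} {J : Set ℕ}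
    (hJ : J.Infinite) {w : J → List A} (hw : ∀ n, w n ≠ []) {x : ℕ → A} {μ ν : Measure (ℕ → A)}
    (hμ : Generates Ω w μ) (hν : IsErgodicMeasure Ω ν) (hx : IsGeneric x ν)
    (h : 0 < disjointDensity L w x) : μ = ν := by
  have := hμ.isInvariantMeasure.isProbabilityMeasure
  have := hν.isProbabilityMeasure
  obtain ⟨c, hc0, hc⟩ := exists_between h
  refine hν.ergodic.eq_of_absolutelyContinuous hμ.isInvariantMeasure.measurePreserving
    (absolutelyContinuous_of_wordCylinder_le (C := ENNReal.ofReal (2 * L / c))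
      ENNReal.ofReal_ne_top fun s hs => ?_)
  have h1 := mul_real_wordCylinder_le hL hJ hw hμ hx hc hs
  rw [← ofReal_measureReal, ← ofReal_measureReal (μ := ν), ← ENNReal.ofReal_mul (by positivity)]
  refine ENNReal.ofReal_le_ofReal ?_
  rw [div_mul_eq_mul_div, le_div_iff₀ hc0]
  linarith

end Domination

/-! ### Colors in the limit graph. -/

section Coloring

variable {A : Type u} [MeasurableSpace A] {Ω : Set (ℕ → A)} {K : ℕ}

lemma LimitGraph.finite_vertices [Finite A] (D : LimitGraph.{u, v} Ω K) : Finite D.Λ.V := by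
  obtain ⟨n, hn⟩ := D.infinite.nonempty
  have : Finite (specialRauzyGraph Ω n).V := finite_specVertex
  exact Finite.of_equiv _ (D.iso ⟨n, hn⟩).vert.symm

lemma LimitGraph.length_word (D : LimitGraph.{u, v} Ω K) (a : D.Λ.V) (n : D.J) :
    (D.word a n).length = n :=
  SpecVertex.word_length _

lemma LimitGraph.word_ne_nil (D : LimitGraph.{u, v} Ω K) (a : D.Λ.V) (n : D.J) :
    D.word a n ≠ [] := by
  have := D.length_word a n
  have := D.pos_of_mem n n.2
  exact List.ne_nil_of_length_pos (by omega)

/-- If a block function with averages more than `δ` is supported on blocks that contain a position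
near an occurrence of a vertex in `S`, then a vertex in `S` has positive density. -/
lemma LimitGraph.exists_disjointDensity_pos [Finite A] (D : LimitGraph.{u, v} Ω K) {L : ℕ}
    (hL : 0 < L) {x : ℕ → A} (S : D.Λ.V → Prop) (f : D.J → ℕ → ℝ) (Q : D.J → ℕ → Prop)
    (hf : ∀ n j, f n j ≤ 1)
    (hfQ : ∀ n j, f n j ≤ 0 ∨ ∃ i, j * (L * n) ≤ i ∧ i < (j + 1) * (L * n) ∧ Q n i)
    (hQ : ∀ᶠ n : D.J in atTop, ∀ i ≥ L * n, Q n i → ∃ a, S a ∧ ∃ i', i ≤ i' + L * n ∧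
      i' ≤ i + L * n ∧ factor x i' n = D.word a n)
    {δ : ℝ} (hδ : 0 < δ)
    (hfreq : ∃ᶠ n : D.J in atTop, ∃ᶠ N : ℕ in atTop, δ < (∑ j ∈ Finset.range N, f n j) / N) :
    ∃ a, S a ∧ 0 < disjointDensity L (D.word a) x := by
  have := D.finite_vertices
  suffices h : ∃ a : {a // S a}, 0 < disjointDensity L (D.word a) x by
    obtain ⟨a, ha⟩ := h
    exact ⟨a, a.2, ha⟩
  refine exists_disjointDensity_pos_of_cover hδ
    ((hfreq.and_eventually hQ).mono fun n hn => ⟨f n, hf n, fun j => ?_, hn.1⟩)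
  refine (hfQ n (j + 1)).imp_right ?_
  rintro ⟨i, h1, h2, h3⟩
  obtain ⟨a, haS, i', h4, h5, h6⟩ := hn.2 i ((Nat.le_mul_of_pos_left _ (Nat.succ_pos j)).trans h1) h3
  have hlen := D.length_word a n
  have hpos : 0 < L * (D.word a n).length :=
    Nat.mul_pos hL (by rw [hlen]; exact D.pos_of_mem n n.2)
  rw [← hlen] at h1 h2 h4 h5 h6
  exact ⟨⟨a, haS⟩, exists_blockIndicator_eq_one hpos h1 h2 h4 h5 h6⟩

/-- Positive density is inherited by vertices that always occur nearby. -/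
lemma LimitGraph.exists_disjointDensity_pos_of_near [Finite A] (D : LimitGraph.{u, v} Ω K) {L : ℕ}
    (hL : 0 < L) {x : ℕ → A} {b : D.Λ.V} (S : D.Λ.V → Prop)
    (hb : 0 < disjointDensity L (D.word b) x)
    (hnear : ∀ᶠ n : D.J in atTop, ∀ i ≥ L * n, factor x i n = D.word b n →
      ∃ a, S a ∧ ∃ i', i ≤ i' + L * n ∧ i' ≤ i + L * n ∧ factor x i' n = D.word a n) :
    ∃ a, S a ∧ 0 < disjointDensity L (D.word a) x := by
  obtain ⟨δ, hδ, hδb⟩ := exists_between hb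
  refine D.exists_disjointDensity_pos hL S (fun n j => blockIndicator L (D.word b n) x j)
    (fun n i => factor x i n = D.word b n) (fun n j => blockIndicator_le_one _ _ _ _)
    (fun n j => ?_) hnear hδ
    ((frequently_lt_wordDensity D.infinite hδb).mono fun n hn => frequently_lt_blockAverage hn)
  unfold blockIndicator
  split_ifs with h
  · obtain ⟨i, h1, h2, h3⟩ := h
    rw [D.length_word b n] at h1 h2
    exact Or.inr ⟨i, h1, h2, h3.factor_eq (D.length_word b n)⟩
  · simp

/-- A set of vertices that is visited in every window contains a vertex of positive density. -/
lemma LimitGraph.exists_disjointDensity_pos_of_window [Finite A] (D : LimitGraph.{u, v} Ω K)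
    {L : ℕ} (hL : 0 < L) {x : ℕ → A} (S : D.Λ.V → Prop)
    (hS : ∀ᶠ n : D.J in atTop, ∀ i, ∃ a, S a ∧ ∃ i', i ≤ i' ∧ i' ≤ i + L * n ∧
      factor x i' n = D.word a n) :
    ∃ a, S a ∧ 0 < disjointDensity L (D.word a) x := by
  have := D.infinite.nonempty.to_subtype
  -- With every window visited, the constant block function 1 is covered, and any `δ` below 1 will
  -- do.
  refine D.exists_disjointDensity_pos hL S (fun _ _ => 1) (fun _ _ => True) (fun _ _ => le_rfl)
    (fun n j => Or.inr ⟨j * (L * n), le_rfl, ?_, trivial⟩)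
    (hS.mono fun n h i _ _ => ?_) (δ := 1 / 2) (by norm_num)
    (Frequently.of_forall fun n => ((eventually_gt_atTop 0).mono fun N hN => ?_).frequently)
  · exact Nat.mul_lt_mul_of_pos_right (Nat.lt_succ_self j)
      (Nat.mul_pos hL (D.pos_of_mem n n.2))
  · obtain ⟨a, ha, i', h1, h2, h3⟩ := h i
    exact ⟨a, ha, i', by omega, h2, h3⟩
  · have : (N : ℝ) ≠ 0 := by exact_mod_cast hN.ne'
    simp only [Finset.sum_const, Finset.card_range, nsmul_eq_mul, mul_one, div_self this]
    norm_num

lemma LimitGraph.adj_unique_of_isRightSpecial (D : LimitGraph.{u, v} Ω K) {b c c' : D.Λ.V}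
    (hb : D.Λ.IsRightSpecial b) (h : D.Λ.Adj c b) (h' : D.Λ.Adj c' b) : c = c' := by
  obtain ⟨n, hn⟩ := D.infinite.nonempty
  set φ := D.iso ⟨n, hn⟩
  exact φ.vert.injective (SpecialRauzy.adj_unique_of_isRightSpecial (φ.isRightSpecial_iff.2 hb)
    (φ.adj_iff.2 h) (φ.adj_iff.2 h'))

lemma LimitGraph.adj_unique_of_isLeftSpecial (D : LimitGraph.{u, v} Ω K) {b c c' : D.Λ.V}
    (hb : D.Λ.IsLeftSpecial b) (h : D.Λ.Adj b c) (h' : D.Λ.Adj b c') : c = c' := by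
  obtain ⟨n, hn⟩ := D.infinite.nonempty
  set φ := D.iso ⟨n, hn⟩
  exact φ.vert.injective (SpecialRauzy.adj_unique_of_isLeftSpecial (φ.isLeftSpecial_iff.2 hb)
    (φ.adj_iff.2 h) (φ.adj_iff.2 h'))

lemma LimitGraph.eventually_complexity_lt (D : LimitGraph.{u, v} Ω K) {N₀ : ℕ}
    (hK : ∀ n ≥ N₀, complexity Ω (n + 1) = complexity Ω n + K) :
    ∀ᶠ n : D.J in atTop, complexity Ω n < (K + 1) * n :=
  (tendsto_coe_atTop D.infinite).eventually (SpecialRauzy.eventually_complexity_lt hK)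

variable [Finite A] [TopologicalSpace A] [DiscreteTopology A]

lemma LimitGraph.exists_adj_to_disjointDensity_pos (hmin : IsMinimalShift Ω)
    (haper : IsAperiodic Ω) {N₀ : ℕ} (hK : ∀ n ≥ N₀, complexity Ω (n + 1) = complexity Ω n + K)
    (D : LimitGraph.{u, v} Ω K) {x : ℕ → A} (hx : x ∈ Ω) {b : D.Λ.V}
    (hb : 0 < disjointDensity (K + 1) (D.word b) x) :
    ∃ c, D.Λ.Adj c b ∧ 0 < disjointDensity (K + 1) (D.word c) x := by
  refine D.exists_disjointDensity_pos_of_near K.succ_pos (fun c => D.Λ.Adj c b) hb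
    ((D.eventually_complexity_lt hK).mono fun n hn i hi h => ?_)
  -- The predecessor depends on `n` and on the occurrence, but carried back to `D.Λ` it ranges over
  -- one fixed finite set.
  obtain ⟨c, hc, i', h1, h2, h3⟩ := exists_adj_before hmin haper hx hn ((D.iso n).vert b) hi h
  obtain ⟨c, rfl⟩ := (D.iso n).vert.surjective c
  exact ⟨c, (D.iso n).adj_iff.1 hc, i', h1, by omega, h3⟩

lemma LimitGraph.exists_adj_from_disjointDensity_pos (hmin : IsMinimalShift Ω)
    (haper : IsAperiodic Ω) {N₀ : ℕ} (hK : ∀ n ≥ N₀, complexity Ω (n + 1) = complexity Ω n + K)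
    (D : LimitGraph.{u, v} Ω K) {x : ℕ → A} (hx : x ∈ Ω) {b : D.Λ.V}
    (hb : 0 < disjointDensity (K + 1) (D.word b) x) :
    ∃ c, D.Λ.Adj b c ∧ 0 < disjointDensity (K + 1) (D.word c) x := by
  refine D.exists_disjointDensity_pos_of_near K.succ_pos (fun c => D.Λ.Adj b c) hb
    ((D.eventually_complexity_lt hK).mono fun n hn i hi h => ?_)
  obtain ⟨c, hc, i', h1, h2, h3⟩ := exists_adj_after hmin haper hx hn ((D.iso n).vert b) h
  obtain ⟨c, rfl⟩ := (D.iso n).vert.surjective c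
  exact ⟨c, (D.iso n).adj_iff.1 hc, i', by omega, h2, h3⟩

lemma LimitGraph.exists_isLeftSpecial_disjointDensity_pos (hmin : IsMinimalShift Ω)
    (haper : IsAperiodic Ω) {N₀ : ℕ} (hK : ∀ n ≥ N₀, complexity Ω (n + 1) = complexity Ω n + K)
    (D : LimitGraph.{u, v} Ω K) {x : ℕ → A} (hx : x ∈ Ω) :
    ∃ a, D.Λ.IsLeftSpecial a ∧ 0 < disjointDensity (K + 1) (D.word a) x := by
  refine D.exists_disjointDensity_pos_of_window K.succ_pos (fun a => D.Λ.IsLeftSpecial a)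
    ((D.eventually_complexity_lt hK).mono fun n hn i => ?_)
  obtain ⟨i', h1, h2, h3⟩ := hmin.exists_leftSpecial_in_window haper hx hn i
  obtain ⟨a, ha⟩ := (D.iso n).vert.surjective (SpecVertex.left _ h3 (length_factor x i' n))
  refine ⟨a, (D.iso n).isLeftSpecial_iff.1 ?_, i', h1, h2.le, ?_⟩
  · rw [ha]
    exact isLeftSpecial_left hmin haper (D.pos_of_mem n n.2) h3 _
  · rw [LimitGraph.word, ha]
    rfl

lemma LimitGraph.exists_isRightSpecial_disjointDensity_pos (hmin : IsMinimalShift Ω)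
    (haper : IsAperiodic Ω) {N₀ : ℕ} (hK : ∀ n ≥ N₀, complexity Ω (n + 1) = complexity Ω n + K)
    (D : LimitGraph.{u, v} Ω K) {x : ℕ → A} (hx : x ∈ Ω) :
    ∃ a, D.Λ.IsRightSpecial a ∧ 0 < disjointDensity (K + 1) (D.word a) x := by
  refine D.exists_disjointDensity_pos_of_window K.succ_pos (fun a => D.Λ.IsRightSpecial a)
    ((D.eventually_complexity_lt hK).mono fun n hn i => ?_)
  obtain ⟨i', h1, h2, h3⟩ := hmin.exists_rightSpecial_in_window haper hx hn i
  obtain ⟨a, ha⟩ := (D.iso n).vert.surjective (SpecVertex.right _ h3 (length_factor x i' n))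
  refine ⟨a, (D.iso n).isRightSpecial_iff.1 ?_, i', h1, h2.le, ?_⟩
  · rw [ha]
    exact isRightSpecial_right hmin haper (D.pos_of_mem n n.2) h3 _
  · rw [LimitGraph.word, ha]
    rfl

lemma LimitGraph.eq_of_colored [DiscreteMeasurableSpace A] (D : LimitGraph.{u, v} Ω K)
    {x : Measure (ℕ → A) → ℕ → A} {a : D.Λ.V} {ν : Measure (ℕ → A)} (hx : IsGeneric (x ν) ν)
    (h : D.Colored x a ν) : D.μ a = ν :=
  eq_of_disjointDensity_pos K.succ_pos D.infinite (D.word_ne_nil a) (D.generates a) h.1 hx h.2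

end Coloring

end SpecialRauzy
theorem proposition4p5 {A : Type u} [Finite A] [TopologicalSpace A] [DiscreteTopology A]
    [MeasurableSpace A] [DiscreteMeasurableSpace A]
    (Ω : Set (ℕ → A)) (hmin : IsMinimalShift Ω) (haper : IsAperiodic Ω)
    (K N₀ : ℕ) (hK : ∀ n ≥ N₀, complexity Ω (n + 1) = complexity Ω n + K)
    (x : Measure (ℕ → A) → ℕ → A)
    (hx : ∀ ν, IsErgodicMeasure Ω ν → x ν ∈ Ω ∧ IsGeneric (x ν) ν)
    (D : LimitGraph.{u, v} Ω K) :
    -- each vertex has at most one color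
    (∀ a ν ν', D.Colored x a ν → D.Colored x a ν' → ν = ν') ∧
    -- every ergodic measure colors a left special vertex and a right special vertex
    (∀ ν, IsErgodicMeasure Ω ν →
      (∃ a, D.Λ.IsLeftSpecial a ∧ D.Colored x a ν) ∧
      (∃ b, D.Λ.IsRightSpecial b ∧ D.Colored x b ν)) ∧
    -- right special vertices
    (∀ b ν, D.Λ.IsRightSpecial b → D.Colored x b ν →
      (∃ c, D.Λ.Adj c b ∧ (∀ c', D.Λ.Adj c' b → c' = c) ∧ D.Colored x c ν) ∧
      (∃ c, D.Λ.Adj b c ∧ D.Colored x c ν)) ∧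
    -- left special vertices
    (∀ a ν, D.Λ.IsLeftSpecial a → D.Colored x a ν →
      (∃ c, D.Λ.Adj a c ∧ (∀ c', D.Λ.Adj a c' → c' = c) ∧ D.Colored x c ν) ∧
      (∃ c, D.Λ.Adj c a ∧ D.Colored x c ν)) := by
  refine ⟨fun a ν ν' h h' => ?_, fun ν hν => ⟨?_, ?_⟩, fun b ν hb hc => ⟨?_, ?_⟩,
    fun b ν hb hc => ⟨?_, ?_⟩⟩
  · rw [← D.eq_of_colored (hx ν h.1).2 h, ← D.eq_of_colored (hx ν' h'.1).2 h']
  · obtain ⟨a, ha, hpos⟩ :=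
      D.exists_isLeftSpecial_disjointDensity_pos hmin haper hK (hx ν hν).1
    exact ⟨a, ha, hν, hpos⟩
  · obtain ⟨a, ha, hpos⟩ :=
      D.exists_isRightSpecial_disjointDensity_pos hmin haper hK (hx ν hν).1
    exact ⟨a, ha, hν, hpos⟩
  · obtain ⟨c, hcb, hpos⟩ := D.exists_adj_to_disjointDensity_pos hmin haper hK (hx ν hc.1).1 hc.2
    exact ⟨c, hcb, fun c' h => D.adj_unique_of_isRightSpecial hb h hcb, hc.1, hpos⟩
  · obtain ⟨c, hcb, hpos⟩ := D.exists_adj_from_disjointDensity_pos hmin haper hK (hx ν hc.1).1 hc.2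
    exact ⟨c, hcb, hc.1, hpos⟩
  · obtain ⟨c, hcb, hpos⟩ := D.exists_adj_from_disjointDensity_pos hmin haper hK (hx ν hc.1).1 hc.2
    exact ⟨c, hcb, fun c' h => D.adj_unique_of_isLeftSpecial hb h hcb, hc.1, hpos⟩
  · obtain ⟨c, hcb, hpos⟩ := D.exists_adj_to_disjointDensity_pos hmin haper hK (hx ν hc.1).1 hc.2
    exact ⟨c, hcb, hc.1, hpos⟩
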